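/- **Setting.** In the infinitely-armed deterministic bandit there is a countably infinite set of actions $\mathcal A=\{1,2,\dots\}$. The rewards $(\theta_a)_{a\in\mathcal A}$ are independent and uniform on $[0,1]$. Playing $a$ at time $t\in\mathbb N_0=\{0,1,2,\dots\}$ yields and reveals $R_{t,a}=Y_{t,a}=\theta_a$, and $R^*=\sup_a\theta_a$. Let $\xi$ be a random variable with values in a standard Borel space, independent of $\theta$. For an action process $(A_t)$ put $\mathcal F_t=(A_0,Y_{0,A_0},\dots,A_{t-1},Y_{t-1,A_{t-1}})$ and write $\mathbf P_t=\mathbf P(\cdot\mid\mathcal F_t)$, $\mathbf E_t=\mathbf E[\cdot\mid\mathcal F_t]$. Satisficing Thompson sampling (STS) with tolerance $\epsilon$ and internal randomness $\xi$ acts as follows in period $t$. It draws, as a function of $(\mathcal F_t,\xi)$, a sample $\hat\theta_t\sim\mathbf P(\theta\mid\mathcal F_t)$. If $\hat\theta_{t,A_k}+\epsilon\ge\sup_a\hat\theta_{t,a}$ for some $k<t$, it plays $A_t=A_k$ for the smallest such $k$. Otherwise it plays an action that has not been played before; since $\sup_a\hat\theta_{t,a}$ is almost surely not attained, this new action is designated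 by the internal randomness, that is, it is a function of $(A_0,\dots,A_{t-1})$ and $\xi$ only. Entropies and mutual informations are taken with the natural logarithm. For an action process $(A_t)$ and a random action $\tilde A$ let $$\mathbf\Gamma(\tilde A,\{A_t\})=(1-\alpha^2)\sum_{t=0}^\infty\alpha^{2t}\,\mathbf E\left[\frac{\mathbf E_t[\theta_{\tilde A}-\theta_{A_t}]^2}{\mathbf I_t(\tilde A;Y_{t,A_t}\mid\xi)}\right]\in[0,\infty],$$ where $\mathbf I_t(\,\cdot\,;\cdot\mid\xi)$ is conditional mutual information given $\xi$ under $\mathbf P_t$, with the conventions $0/0=0$ and $x/0=\infty$ for $x>0$. **Theorem.** Let $\alpha\in(0,1)$ and $\epsilon\in(0,1)$, let $(A_t)_{t\in\mathbb N_0}$ be generated by STS with tolerance $\epsilon$ in the infinitely-armed deterministic bandit, and let $\tau=\min\{t:\theta_{A_t}\ge 1-\epsilon\}$ and $\tilde A=A_\tau$. Then $\tau$ is almost surely finite and geometric with parameter $\epsilon$, i.e. $\mathbf P(\tau=k)=\epsilon(1-\epsilon)^k$ for $k=0,1,2,\dots$; moreover $0<\mathbf H(\tau)<\infty$, and $$\mathbf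 H(\tilde A\mid\xi)=\mathbf H(\tau),\qquad \mathbf\Gamma(\tilde A,\{A_t\})\le\frac{1}{4\epsilon\,\mathbf H(\tau)}.$$ If in addition $\epsilon=\sqrt{(1-\alpha)/2}$, then $\sum_{t\ge0}\alpha^t(R^*-R_{t,A_t})$ converges almost surely and is integrable, and $$\mathbf E\left[\sum_{t=0}^\infty\alpha^t(R^*-R_{t,A_t})\right]\le\sqrt{\frac{2}{1-\alpha}}.$$ -/

import Mathlib

open MeasureTheory ProbabilityTheory
open scoped ENNReal

noncomputable section

namespace SatisficingBandit

/-! ### Entropy and conditional mutual information (natural logarithms, values in `[0, ∞]`) -/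

/-- Shannon entropy `- ∑ p(s) log p(s)` of a probability measure on a countable space. -/
def entropyOfLaw {S : Type*} [MeasurableSpace S] (p : Measure S) : ℝ≥0∞ :=
  ∑' s : S, ENNReal.ofReal (Real.negMulLog (p.real {s}))

/-- Entropy `H(X)` of a discrete random variable. -/
def entropy {Ω S : Type*} [MeasurableSpace Ω] [MeasurableSpace S] (μ : Measure Ω)
    (X : Ω → S) : ℝ≥0∞ :=
  entropyOfLaw (μ.map X)

/-- Conditional entropy `H(X | Z)`: the average over `z` of the entropy of the conditional law of
the discrete random variable `X` given `Z = z`. -/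
def condEntropy {Ω S Z : Type*} [MeasurableSpace Ω] [MeasurableSpace S] [StandardBorelSpace S]
    [Nonempty S] [MeasurableSpace Z] (μ : Measure Ω) [IsFiniteMeasure μ]
    (X : Ω → S) (W : Ω → Z) : ℝ≥0∞ :=
  ∫⁻ z, entropyOfLaw (condDistrib X W μ z) ∂(μ.map W)

/-- Conditional mutual information `I(X; Y | Z)` as a functional of the law `ρ` of `(Z, (X, Y))`:
the average over `z` of the Kullback-Leibler divergence between the conditional law of `(X, Y)`
given `Z = z` and the product of its two marginals. -/
def condMutualInfoOfLaw {S T Z : Type*} [MeasurableSpace S] [StandardBorelSpace S] [Nonempty S]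
    [MeasurableSpace T] [StandardBorelSpace T] [Nonempty T] [MeasurableSpace Z]
    (ρ : Measure (Z × (S × T))) [IsFiniteMeasure ρ] : ℝ≥0∞ :=
  ∫⁻ z, InformationTheory.klDiv (ρ.condKernel z)
    ((ρ.condKernel z).fst.prod (ρ.condKernel z).snd) ∂ρ.fst

/-! ### The infinitely-armed deterministic bandit

Actions are labelled by `ℕ`, the reward of action `a` is `θ a`, and playing `a` reveals `θ a`, so
that the outcome at time `t` (and that of an independent copy given `θ`) is `Y_{t,a} = θ a`. -/

/-- The mean rewards are independent and uniform on `[0, 1]`, and the exogenous random variable `ξ`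
is independent of them. -/
structure IsDeterministicBandit {Ω Ξ : Type*} [MeasurableSpace Ω] [MeasurableSpace Ξ]
    (μ : Measure Ω) (θ : ℕ → Ω → ℝ) (ξ : Ω → Ξ) : Prop where
  measurable_reward : ∀ a, Measurable (θ a)
  uniform : ∀ a, pdf.IsUniform (θ a) (Set.Icc 0 1) μ
  indep : iIndepFun θ μ
  measurable_exogenous : Measurable ξ
  indep_exogenous : IndepFun ξ (fun ω a => θ a ω) μ

/-- Values of the history `F_t = (A_0, Y_{0,A_0}, …, A_{t-1}, Y_{t-1,A_{t-1}})`. -/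
abbrev History (t : ℕ) : Type := Fin t → ℕ × ℝ

/-- The history `F_t` of the action process `A`. -/
def history {Ω : Type*} (θ : ℕ → Ω → ℝ) (A : ℕ → Ω → ℕ) (t : ℕ) (ω : Ω) : History t :=
  fun k => (A k ω, θ (A k ω) ω)

/-- The optimal reward `R* = sup_a θ_a`. -/
def optReward {Ω : Type*} (θ : ℕ → Ω → ℝ) (ω : Ω) : ℝ := ⨆ a, θ a ω

/-- The previously played action `A_k` is `ε`-optimal for the sampled model `v`. -/
def Satisfactory {Ω : Type*} (ε : ℝ) (A : ℕ → Ω → ℕ) (v : ℕ → ℝ) (ω : Ω) (k : ℕ) : Prop :=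
  (⨆ a, v a) ≤ v (A k ω) + ε

/-- `A` is generated by satisficing Thompson sampling with tolerance `ε`, with internal
randomness `ξ`. In period `t`:

* a model `sample t (F_t, ξ)` is drawn from the posterior distribution of `θ` given `F_t`;
* if some action `A_k`, `k < t`, is within `ε` of the optimum in the sampled model, the one with
  the smallest `k` is played;
* otherwise an action which has not been played before is played. As the supremum of the sampled
  model is almost surely not attained, the algorithm's internal randomness designates which one:
  it depends on the actions played so far and on `ξ`, and not on the observed rewards. -/
def IsSTS {Ω Ξ : Type*} [MeasurableSpace Ω] [MeasurableSpace Ξ]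
    (μ : Measure Ω) [IsFiniteMeasure μ] (θ : ℕ → Ω → ℝ) (ξ : Ω → Ξ) (ε : ℝ)
    (A : ℕ → Ω → ℕ) : Prop :=
  ∃ (sample : ∀ t, History t × Ξ → ℕ → ℝ) (fresh : ∀ t, (Fin t → ℕ) × Ξ → ℕ),
    (∀ t, Measurable (sample t)) ∧
    (∀ t, Measurable (fresh t)) ∧
    (∀ t past x, ∀ k : Fin t, fresh t (past, x) ≠ past k) ∧
    (∀ t, condDistrib (fun ω => sample t (history θ A t ω, ξ ω)) (history θ A t) μ
        =ᵐ[μ.map (history θ A t)]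
      condDistrib (fun ω a => θ a ω) (history θ A t) μ) ∧
    (∀ t ω, ∀ k < t,
      Satisfactory ε A (sample t (history θ A t ω, ξ ω)) ω k →
      (∀ j < k, ¬ Satisfactory ε A (sample t (history θ A t ω, ξ ω)) ω j) →
      A t ω = A k ω) ∧
    (∀ t ω,
      (∀ k < t, ¬ Satisfactory ε A (sample t (history θ A t ω, ξ ω)) ω k) →
      A t ω = fresh t (fun k => A k ω, ξ ω))

/-- `τ = min {t | θ_{A_t} ≥ 1 - ε}` (with value `0` if there is no such `t`). -/
def firstSatisfactory {Ω : Type*} (θ : ℕ → Ω → ℝ) (A : ℕ → Ω → ℕ) (ε : ℝ) (ω : Ω) : ℕ :=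
  sInf {t | 1 - ε ≤ θ (A t ω) ω}

/-- The benchmark action `Ã = A_τ`. -/
def benchmark {Ω : Type*} (θ : ℕ → Ω → ℝ) (A : ℕ → Ω → ℕ) (ε : ℝ) (ω : Ω) : ℕ :=
  A (firstSatisfactory θ A ε ω) ω

/-! ### The modified information ratio -/

/-- `E_t[R̃ - R_{t,A_t}]`, where `R̃ = θ_Ã`. -/
def expectedShortfall {Ω : Type*} [MeasurableSpace Ω] (μ : Measure Ω) (θ : ℕ → Ω → ℝ)
    (A : ℕ → Ω → ℕ) (B : Ω → ℕ) (t : ℕ) : Ω → ℝ :=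
  μ[fun ω => θ (B ω) ω - θ (A t ω) ω |
    MeasurableSpace.comap (history θ A t) inferInstance]

/-- `I_t(Ã; Y_{t,A_t} | ξ)`: the conditional mutual information of `Ã` and `Y_{t,A_t}` given `ξ`,
computed under the posterior distribution `P(· | F_t)`. -/
def informationGain {Ω Ξ : Type*} [MeasurableSpace Ω] [MeasurableSpace Ξ] [StandardBorelSpace Ξ]
    [Nonempty Ξ] (μ : Measure Ω) [IsFiniteMeasure μ] (θ : ℕ → Ω → ℝ) (ξ : Ω → Ξ)
    (A : ℕ → Ω → ℕ) (B : Ω → ℕ) (t : ℕ) (ω : Ω) : ℝ≥0∞ :=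
  condMutualInfoOfLaw
    (condDistrib (fun ω' => (ξ ω', (B ω', θ (A t ω') ω'))) (history θ A t) μ (history θ A t ω))

/-- `Γ(Ã, {A_t}) = (1 - α²) ∑ₜ α^{2t} E[E_t[R̃ - R_{t,A_t}]² / I_t(Ã; Y_{t,A_t} | ξ)]`, in `[0, ∞]`,
with the conventions `0 / 0 = 0` and `x / 0 = ∞` for `x > 0`. -/
def informationRatio {Ω Ξ : Type*} [MeasurableSpace Ω] [MeasurableSpace Ξ] [StandardBorelSpace Ξ]
    [Nonempty Ξ] (μ : Measure Ω) [IsFiniteMeasure μ] (θ : ℕ → Ω → ℝ) (ξ : Ω → Ξ) (α : ℝ)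
    (B : Ω → ℕ) (A : ℕ → Ω → ℕ) : ℝ≥0∞ :=
  ENNReal.ofReal (1 - α ^ 2) * ∑' t : ℕ, ENNReal.ofReal (α ^ (2 * t)) *
    ∫⁻ ω, ENNReal.ofReal (expectedShortfall μ θ A B t ω ^ 2) /
      informationGain μ θ ξ A B t ω ∂μ

end SatisficingBandit

end

/-! A posterior sample has the same joint law with the history as the true model. Almost surely,
therefore, its supremum is `1` and it reproduces every reward already observed (`ae_sample_eq`). The
satisficing test on a played arm thus reduces to the test that its true reward is at least `1 - ε`.
The agent tries distinct arms `b ξ 0, b ξ 1, …`, in an order fixed by `ξ` alone, and keeps the first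
satisfactory one (`IsSTS.exists_isSequentialSearch`). Since the order is injective and `ξ` is
independent of the rewards, the rewards read in this order are again independent and uniform, and
independent of `ξ` (`map_exogenous_reorder`). Everything becomes a question about the first entrance
of an i.i.d. uniform sequence into `[1 - ε, 1]`.

With `h` the binary entropy, the entrance time is geometric and its entropy is `h(ε) / ε`. Given
`ξ`, the benchmark is an injective image of this time, so it has the same conditional entropy.

For the information ratio, once a satisfactory arm has been found the benchmark is the arm being
played and the shortfall is zero. Before that, the future rewards are independent of the history and
of `ξ`, so the expected shortfall is a constant, at most the mean `1/2` of one minus a uniform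
variable (`ae_expectedShortfall`). Meanwhile both the benchmark and the observed reward reveal
whether the new arm is satisfactory, an event of probability `ε`; by data processing the information
gain is at least `h(ε)` (`ae_le_informationGain`). Each expected ratio is thus at most `1 / (4 h(ε))
= 1 / (4 ε H(τ))`, and the weights `(1 - α²) α^(2t)` sum to one.

The regret is bounded directly and not through the ratio. The optimum is almost surely `1`, and the
regret at time `t` is at most `ε`, plus `1 - x_t` on the event that the first `t` trials all failed.
Its mean is at most `ε + (1 - ε)^t / 2`, and the discounted sum is at most `ε / (1 - α) + 1 / (2ε)`;
the chosen tolerance makes these two terms equal. -/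

noncomputable section

namespace SatisficingBandit

/-! ### Sequences of independent uniform rewards -/

/-- The uniform distribution on `[0, 1]`. -/
def unitUniform : Measure ℝ := ProbabilityTheory.cond volume (Set.Icc 0 1)

lemma unitUniform_eq : unitUniform = volume.restrict (Set.Icc 0 1) := by
  simp [unitUniform, ProbabilityTheory.cond]

instance : IsProbabilityMeasure unitUniform := by
  rw [unitUniform_eq]
  exact ⟨by simp⟩

lemma ae_mem_Icc_unitUniform : ∀ᵐ x ∂unitUniform, x ∈ Set.Icc (0 : ℝ) 1 := by
  rw [unitUniform_eq]
  exact ae_restrict_mem measurableSet_Icc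

lemma unitUniform_Ici {ε : ℝ} (h1 : ε < 1) :
    unitUniform (Set.Ici (1 - ε)) = ENNReal.ofReal ε := by
  rw [unitUniform_eq, Measure.restrict_apply measurableSet_Ici]
  have : Set.Ici (1 - ε) ∩ Set.Icc 0 1 = Set.Icc (1 - ε) 1 := by
    ext x
    simp only [Set.mem_inter_iff, Set.mem_Ici, Set.mem_Icc]
    constructor
    · rintro ⟨a, b, c⟩; exact ⟨a, c⟩
    · rintro ⟨a, b⟩; exact ⟨a, by linarith, b⟩
  rw [this, Real.volume_Icc]
  congr 1
  ring

lemma unitUniform_Iio {ε : ℝ} (h0 : 0 < ε) :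
    unitUniform (Set.Iio (1 - ε)) = ENNReal.ofReal (1 - ε) := by
  rw [unitUniform_eq, Measure.restrict_apply measurableSet_Iio]
  have : Set.Iio (1 - ε) ∩ Set.Icc 0 1 = Set.Ico 0 (1 - ε) := by
    ext x
    simp only [Set.mem_inter_iff, Set.mem_Iio, Set.mem_Icc, Set.mem_Ico]
    constructor
    · rintro ⟨a, b, c⟩; exact ⟨b, a⟩
    · rintro ⟨a, b⟩; exact ⟨b, a, by linarith⟩
  rw [this, Real.volume_Ico]
  congr 1
  ring

lemma integral_unitUniform : ∫ x, x ∂unitUniform = 1 / 2 := by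
  rw [unitUniform_eq, integral_Icc_eq_integral_Ioc,
    ← intervalIntegral.integral_of_le zero_le_one, integral_id]
  norm_num

/-- The law of a sequence of independent rewards which are uniform on `[0, 1]`. -/
def rewardLaw : Measure (ℕ → ℝ) := Measure.infinitePi fun _ => unitUniform

instance : IsProbabilityMeasure rewardLaw := by
  unfold rewardLaw; infer_instance

lemma measurePreserving_eval_rewardLaw (k : ℕ) :
    MeasurePreserving (fun x : ℕ → ℝ => x k) rewardLaw unitUniform :=
  measurePreserving_eval_infinitePi (fun _ : ℕ => unitUniform) k

lemma map_comp_rewardLaw {f : ℕ → ℕ} (hf : Function.Injective f) :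
    rewardLaw.map (fun x k => x (f k)) = rewardLaw :=
  Measure.map_infinitePi_infinitePi_of_inj (P := fun _ : ℕ => unitUniform) hf

lemma ae_mem_Icc_rewardLaw : ∀ᵐ x ∂rewardLaw, ∀ k, x k ∈ Set.Icc (0 : ℝ) 1 :=
  ae_all_iff.2 fun k =>
    (measurePreserving_eval_rewardLaw k).quasiMeasurePreserving.ae ae_mem_Icc_unitUniform

/-- The two blocks are generated by coordinates in the disjoint index sets `{i < t}` and `{t ≤ i}`.
-/
lemma indepFun_split_rewardLaw (t : ℕ) :
    IndepFun (fun (x : ℕ → ℝ) (k : Fin t) => x k) (fun x j => x (t + j)) rewardLaw := by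
  have h : iIndepFun (fun (i : ℕ) (x : ℕ → ℝ) => x i) rewardLaw :=
    iIndepFun_infinitePi (P := fun _ : ℕ => unitUniform) (X := fun _ x => x) fun _ => measurable_id
  have hd : Disjoint {i : ℕ | i < t} {i | t ≤ i} := by
    rw [Set.disjoint_left]
    intro i hi hj
    simp only [Set.mem_ofPred_eq] at hi hj
    omega
  have := indep_iSup_of_disjoint (fun i => (measurable_pi_apply i).comap_le) h hd
  rw [IndepFun_iff_Indep]
  refine indep_of_indep_of_le_left (indep_of_indep_of_le_right this ?_) ?_
  · simp_rw [MeasurableSpace.pi, MeasurableSpace.comap_iSup, MeasurableSpace.comap_comp]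
    exact iSup_le fun j => le_iSup₂_of_le (t + j) (by simp) le_rfl
  · simp_rw [MeasurableSpace.pi, MeasurableSpace.comap_iSup, MeasurableSpace.comap_comp]
    exact iSup_le fun j => le_iSup₂_of_le (j : ℕ) (by simp) le_rfl

lemma measurePreserving_split_rewardLaw (t : ℕ) :
    MeasurePreserving (fun x : ℕ → ℝ => ((fun k : Fin t => x k), fun j => x (t + j))) rewardLaw
      ((rewardLaw.map fun (x : ℕ → ℝ) (k : Fin t) => x k).prod rewardLaw) := by
  refine ⟨by fun_prop, ?_⟩
  have h := (indepFun_iff_map_prod_eq_prod_map_map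
    (Measurable.aemeasurable (by fun_prop)) (Measurable.aemeasurable (by fun_prop))).1
    (indepFun_split_rewardLaw t)
  rw [h, map_comp_rewardLaw (add_right_injective t)]

/-! ### First entrance time into the satisfactory level. -/

/-- The first index at which the sequence `x` is within `ε` of `1`. -/
def hittingTime (ε : ℝ) (x : ℕ → ℝ) : ℕ := sInf {t | 1 - ε ≤ x t}

lemma le_hittingTime {ε : ℝ} {x : ℕ → ℝ} (h : ∃ t, 1 - ε ≤ x t) :
    1 - ε ≤ x (hittingTime ε x) :=
  Nat.sInf_mem (s := {t | 1 - ε ≤ x t}) h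

lemma lt_of_lt_hittingTime {ε : ℝ} {x : ℕ → ℝ} {k : ℕ} (h : k < hittingTime ε x) :
    x k < 1 - ε :=
  not_le.1 (Nat.notMem_of_lt_sInf h)

lemma hittingTime_eq_iff {ε : ℝ} {x : ℕ → ℝ} (h : ∃ t, 1 - ε ≤ x t) (n : ℕ) :
    hittingTime ε x = n ↔ 1 - ε ≤ x n ∧ ∀ k < n, x k < 1 - ε := by
  constructor
  · rintro rfl
    exact ⟨le_hittingTime h, fun k hk => lt_of_lt_hittingTime hk⟩
  · rintro ⟨h1, h2⟩
    refine le_antisymm (Nat.sInf_le h1) (not_lt.1 fun hlt => ?_)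
    exact absurd (le_hittingTime h) (not_le.2 (h2 _ hlt))

lemma le_hittingTime_iff {ε : ℝ} {x : ℕ → ℝ} (h : ∃ t, 1 - ε ≤ x t) (n : ℕ) :
    n ≤ hittingTime ε x ↔ ∀ k < n, x k < 1 - ε := by
  constructor
  · intro hn k hk
    exact lt_of_lt_hittingTime (hk.trans_le hn)
  · intro h2
    exact not_lt.1 fun hlt => absurd (le_hittingTime h) (not_le.2 (h2 _ hlt))

lemma hittingTime_shift {ε : ℝ} {x : ℕ → ℝ} (h : ∃ t, 1 - ε ≤ x t) {t : ℕ}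
    (ht : t ≤ hittingTime ε x) :
    t + hittingTime ε (fun j => x (t + j)) = hittingTime ε x := by
  symm
  have hs : ∃ j, 1 - ε ≤ x (t + j) :=
    ⟨hittingTime ε x - t, by rw [Nat.add_sub_cancel' ht]; exact le_hittingTime h⟩
  rw [hittingTime_eq_iff h]
  refine ⟨le_hittingTime (x := fun j => x (t + j)) hs, fun k hk => ?_⟩
  rcases lt_or_ge k t with hkt | hkt
  · exact (le_hittingTime_iff h t).1 ht k hkt
  · have := lt_of_lt_hittingTime (x := fun j => x (t + j)) (k := k - t) (ε := ε) (by omega)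
    simpa [Nat.add_sub_cancel' hkt] using this

lemma measurable_hittingTime (ε : ℝ) : Measurable (hittingTime ε) := by
  have hs : ∀ n : ℕ, MeasurableSet {x : ℕ → ℝ | 1 - ε ≤ x n} := fun n =>
    measurableSet_le measurable_const (measurable_pi_apply n)
  refine measurable_of_Iio fun n => ?_
  -- The last piece accounts for the default `sInf ∅ = 0`: a sequence that never enters has hitting
  -- time `0`.
  have : hittingTime ε ⁻¹' Set.Iio n =
      (⋃ k, ⋃ (_ : k < n), {x | 1 - ε ≤ x k}) ∪ ({x | 0 < n} ∩ ⋂ k, {x | 1 - ε ≤ x k}ᶜ) := by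
    ext x
    simp only [Set.mem_preimage, Set.mem_Iio, Set.mem_ofPred_eq, Set.mem_union, Set.mem_iUnion,
      Set.mem_inter_iff, Set.mem_iInter, Set.mem_compl_iff, exists_prop]
    by_cases h : ∃ t, 1 - ε ≤ x t
    · rw [← not_iff_not, not_lt, le_hittingTime_iff h]
      push Not
      refine ⟨fun h' => ⟨h', fun _ => h⟩, fun h' => h'.1⟩
    · have h0 : hittingTime ε x = 0 := by
        have : {t | 1 - ε ≤ x t} = ∅ := by
          exact Set.eq_empty_iff_forall_notMem.2 fun t ht => h ⟨t, ht⟩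
        rw [hittingTime, this, Nat.sInf_empty]
      rw [h0]
      push Not at h
      constructor
      · exact fun hn => Or.inr ⟨hn, fun k => not_le.2 (h k)⟩
      · rintro (⟨k, hk, -⟩ | ⟨hn, -⟩)
        · omega
        · exact hn
  rw [this]
  exact (MeasurableSet.iUnion fun k => MeasurableSet.iUnion fun _ => hs k).union
    ((MeasurableSet.const _).inter (MeasurableSet.iInter fun k => (hs k).compl))

lemma rewardLaw_forall_lt {ε : ℝ} (h0 : 0 < ε) (n : ℕ) :
    rewardLaw {x | ∀ k < n, x k < 1 - ε} = ENNReal.ofReal (1 - ε) ^ n := by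
  have : {x : ℕ → ℝ | ∀ k < n, x k < 1 - ε} =
      Set.pi (Finset.range n) fun _ => Set.Iio (1 - ε) := by
    ext; simp [Set.mem_pi]
  rw [this, rewardLaw, Measure.infinitePi_pi _ fun _ _ => measurableSet_Iio]
  simp [unitUniform_Iio h0]

/-- Never entering has probability at most `(1 - ε)^n` for every `n`. Values `ε ≥ 1` are allowed,
and `ae_iSup_rewardLaw` uses `ε = 1`. -/
lemma ae_exists_le {ε : ℝ} (h0 : 0 < ε) :
    ∀ᵐ x ∂rewardLaw, ∃ t, 1 - ε ≤ x t := by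
  rw [ae_iff, ← nonpos_iff_eq_zero]
  have hlim := ENNReal.tendsto_pow_atTop_nhds_zero_of_lt_one (r := ENNReal.ofReal (1 - ε))
    (by rw [ENNReal.ofReal_lt_one]; linarith)
  refine ge_of_tendsto' hlim fun n => ?_
  rw [← rewardLaw_forall_lt h0 n]
  refine measure_mono fun x hx k _ => ?_
  simp only [Set.mem_ofPred_eq, not_exists, not_le] at hx
  exact hx k

lemma map_hittingTime (ε : unitInterval) (hε : (ε : ℝ) ∈ Set.Ioo (0 : ℝ) 1) :
    rewardLaw.map (hittingTime ε) = geometricMeasure ε := by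
  refine Measure.ext_of_singleton fun n => ?_
  have hne : ε ≠ 0 := fun h => by simp [h] at hε
  rw [geometricMeasure_singleton hne, Measure.map_apply (measurable_hittingTime _) (by simp)]
  -- The event is a box of `n` failures followed by one success, up to the null set of sequences
  -- that never enter. The product measure of the box is then read off.
  have hbox : hittingTime (ε : ℝ) ⁻¹' {n} =ᵐ[rewardLaw]
      Set.pi (Finset.range (n + 1))
        (fun k => if k = n then Set.Ici (1 - (ε : ℝ)) else Set.Iio (1 - (ε : ℝ))) := by
    filter_upwards [ae_exists_le hε.1] with x hx
    rw [eq_iff_iff]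
    change hittingTime (ε : ℝ) x = n ↔ x ∈ Set.pi _ _
    rw [hittingTime_eq_iff hx]
    simp only [Set.mem_pi, Finset.coe_range, Set.mem_Iio]
    constructor
    · rintro ⟨ha, hb⟩ k hk
      split_ifs with hkn
      · subst hkn; exact ha
      · exact hb k (by omega)
    · intro h
      refine ⟨by simpa using h n (by omega), fun k hk => ?_⟩
      simpa [hk.ne] using h k (by omega)
  rw [measure_congr hbox, rewardLaw, Measure.infinitePi_pi, Finset.prod_range_succ]
  · rw [Finset.prod_congr rfl (g := fun _ => ENNReal.ofReal (1 - (ε : ℝ)))]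
    · simp only [Finset.prod_const, Finset.card_range, if_true]
      rw [unitUniform_Ici hε.2, ENNReal.ofReal_mul (by have := hε.2; bound),
        ENNReal.ofReal_pow (by have := hε.2; linarith)]
    · intro k hk
      rw [if_neg (by simp at hk; omega), unitUniform_Iio hε.1]
  · intro k _
    split_ifs
    · exact measurableSet_Ici
    · exact measurableSet_Iio

lemma integral_eval_rewardLaw (k : ℕ) : ∫ x : ℕ → ℝ, x k ∂rewardLaw = 1 / 2 := by
  rw [← integral_unitUniform, ← (measurePreserving_eval_rewardLaw k).map_eq]
  exact (integral_map (measurePreserving_eval_rewardLaw k).measurable.aemeasurable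
      aestronglyMeasurable_id).symm

lemma integrable_eval_rewardLaw (k : ℕ) : Integrable (fun x : ℕ → ℝ => x k) rewardLaw := by
  refine Integrable.of_bound (C := 1) (measurable_pi_apply k).aestronglyMeasurable ?_
  filter_upwards [ae_mem_Icc_rewardLaw] with x hx
  rw [Real.norm_eq_abs, abs_le]
  exact ⟨by linarith [(hx k).1], (hx k).2⟩

/-! ### Entropy of the geometric distribution and mutual information of a binary variable -/

/-- The logarithm of `(1 - e)^n e` is affine in `n`, so the entropy is a combination of the series
`∑ n q^n` and `∑ q^n` with `q = 1 - e`. -/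
lemma entropyOfLaw_geometricMeasure (ε : unitInterval) (hε : (ε : ℝ) ∈ Set.Ioo (0 : ℝ) 1) :
    entropyOfLaw (geometricMeasure ε) = ENNReal.ofReal (Real.binEntropy ε / ε) := by
  have hne : ε ≠ 0 := fun h => by simp [h] at hε
  obtain ⟨h0, h1⟩ := hε
  set e : ℝ := Subtype.val ε
  have h1' : 0 < 1 - e := by linarith
  have hterm : ∀ n : ℕ, Real.negMulLog ((1 - e) ^ n * e) =
      -(e * Real.log (1 - e)) * (n * (1 - e) ^ n) + -(e * Real.log e) * (1 - e) ^ n := by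
    intro n
    rw [Real.negMulLog, Real.log_mul (pow_pos h1' n).ne' h0.ne', Real.log_pow]
    ring
  have hnorm : ‖1 - e‖ < 1 := by rw [Real.norm_of_nonneg h1'.le]; linarith
  have hsum : HasSum (fun n : ℕ => Real.negMulLog ((1 - e) ^ n * e)) (Real.binEntropy e / e) := by
    simp_rw [hterm]
    have hval : Real.binEntropy e / e = -(e * Real.log (1 - e)) * ((1 - e) / (1 - (1 - e)) ^ 2) +
        -(e * Real.log e) * (1 - (1 - e))⁻¹ := by
      rw [Real.binEntropy, Real.log_inv, Real.log_inv, sub_sub_cancel]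
      field_simp
      ring
    rw [hval]
    exact ((hasSum_coe_mul_geometric_of_norm_lt_one hnorm).mul_left _).add
      ((hasSum_geometric_of_norm_lt_one hnorm).mul_left _)
  have hnn : ∀ n : ℕ, 0 ≤ Real.negMulLog ((1 - e) ^ n * e) := fun n =>
    Real.negMulLog_nonneg (mul_nonneg (pow_nonneg h1'.le n) h0.le)
      (mul_le_one₀ (pow_le_one₀ h1'.le (by linarith)) h0.le h1.le)
  rw [← hsum.tsum_eq, ENNReal.ofReal_tsum_of_nonneg hnn hsum.summable, entropyOfLaw]
  simp_rw [geometricMeasure_real_singleton hne]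
  rfl

lemma entropyOfLaw_map_of_injective (p : Measure ℕ) {g : ℕ → ℕ} (hg : Function.Injective g) :
    entropyOfLaw (p.map g) = entropyOfLaw p := by
  have hmap : ∀ s : ℕ, (p.map g).real {s} = p.real (g ⁻¹' {s}) := fun s =>
    map_measureReal_apply .of_discrete (by simp)
  unfold entropyOfLaw
  simp_rw [hmap]
  rw [← hg.tsum_eq]
  · refine tsum_congr fun n => ?_
    rw [← Set.image_singleton, Set.preimage_image_eq _ hg]
  · intro s hs
    by_contra hr
    refine hs ?_
    have : g ⁻¹' {s} = ∅ := Set.preimage_singleton_eq_empty.2 hr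
    simp [this]

/-- The diagonal law has density `1 / P {b}` at `(b, b)` with respect to the product, so the
divergence is the mean of `log (1 / P {b})`. Only this inequality is needed later. -/
lemma binEntropy_le_klDiv_diag {e : ℝ} (h0 : 0 < e) (h1 : e < 1) (P : Measure Bool)
    [IsProbabilityMeasure P] (ht : P {true} = ENNReal.ofReal e)
    (hf : P {false} = ENNReal.ofReal (1 - e)) :
    ENNReal.ofReal (Real.binEntropy e) ≤
      InformationTheory.klDiv (P.map fun b => (b, b)) (P.prod P) := by
  have hP0 : ∀ b, P {b} ≠ 0 := by
    rintro (_ | _)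
    · rw [hf]; simpa using h1
    · rw [ht]; simpa using h0
  set f : Bool × Bool → ℝ≥0∞ := fun p => if p.1 = p.2 then (P {p.1})⁻¹ else 0 with hfdef
  have hd : P.map (fun b => (b, b)) = (P.prod P).withDensity f := by
    refine Measure.ext_of_singleton fun p => ?_
    obtain ⟨a, b⟩ := p
    rw [Measure.map_apply .of_discrete (by simp), withDensity_apply _ (by simp),
      Measure.restrict_singleton, lintegral_smul_measure, lintegral_dirac,
      ← Set.singleton_prod_singleton, Measure.prod_prod]
    by_cases hab : a = b
    · subst hab
      have : (fun b : Bool => (b, b)) ⁻¹' ({a} ×ˢ {a}) = {a} := by ext; simp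
      rw [this]
      simp only [hfdef, if_true, smul_eq_mul]
      rw [mul_assoc, ENNReal.mul_inv_cancel (hP0 a) (measure_ne_top _ _), mul_one]
    · have : (fun b : Bool => (b, b)) ⁻¹' ({a} ×ˢ {b}) = ∅ := by
        ext c
        simp only [Set.mem_preimage, Set.mem_prod, Set.mem_singleton_iff, Set.mem_empty_iff_false,
          iff_false, not_and]
        rintro rfl; exact hab
      rw [this]
      simp [hfdef, hab]
  have hac : P.map (fun b => (b, b)) ≪ P.prod P := hd ▸ withDensity_absolutelyContinuous _ _
  have : IsProbabilityMeasure (P.map fun b => (b, b)) :=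
    Measure.isProbabilityMeasure_map Measurable.of_discrete.aemeasurable
  rw [InformationTheory.klDiv_of_ac_of_integrable hac .of_finite]
  simp only [probReal_univ, add_sub_cancel_right]
  refine ENNReal.ofReal_le_ofReal (le_of_eq ?_)
  have hrn : llr (P.map fun b => (b, b)) (P.prod P) =ᵐ[P.map fun b => (b, b)]
      fun p => Real.log (f p).toReal := by
    refine hac.ae_le ?_
    have := Measure.rnDeriv_withDensity (P.prod P) (f := f) .of_discrete
    rw [← hd] at this
    filter_upwards [this] with p hp
    rw [llr, hp]
  rw [integral_congr_ae hrn, integral_map Measurable.of_discrete.aemeasurable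
    Measurable.of_discrete.aestronglyMeasurable, integral_fintype .of_finite]
  simp [hfdef, measureReal_def, ht, hf, ENNReal.toReal_ofReal h0.le,
    ENNReal.toReal_ofReal (sub_nonneg.2 h1.le), Real.binEntropy]
  ring

/-- If `S` and `T` reveal whether or not an event of probability `e` occurs, their mutual
information is at least the entropy of this event. -/
lemma binEntropy_le_klDiv_of_reveal {Ω S T : Type*} [MeasurableSpace Ω] [MeasurableSpace S]
    [MeasurableSpace T] {e : ℝ} (h0 : 0 < e) (h1 : e < 1) (μ : Measure Ω) [IsProbabilityMeasure μ]
    {X : Ω → S} {Y : Ω → T} (hX : Measurable X) (hY : Measurable Y)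
    {f : S → Bool} {g : T → Bool} (hf : Measurable f) (hg : Measurable g)
    (hfg : ∀ᵐ ω ∂μ, f (X ω) = g (Y ω)) (he : μ {ω | g (Y ω) = true} = ENNReal.ofReal e) :
    ENNReal.ofReal (Real.binEntropy e) ≤
      InformationTheory.klDiv (μ.map fun ω => (X ω, Y ω))
        ((μ.map fun ω => (X ω, Y ω)).fst.prod (μ.map fun ω => (X ω, Y ω)).snd) := by
  have := Measure.isProbabilityMeasure_map (μ := μ) hX.aemeasurable
  have := Measure.isProbabilityMeasure_map (μ := μ) hY.aemeasurable
  have := Measure.isProbabilityMeasure_map (μ := μ) (hX.prodMk hY).aemeasurable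
  have hgY := Measure.isProbabilityMeasure_map (μ := μ) (hg.comp hY).aemeasurable
  rw [Measure.fst_map_prodMk hY, Measure.snd_map_prodMk hX]
  -- Data processing: passing to the two binary statistics can only decrease the divergence. They
  -- agree almost surely, so their joint law is diagonal.
  refine le_trans ?_ (InformationTheory.klDiv_map_le _ _ (hf.prodMap hg))
  rw [← Measure.map_prod_map _ _ hf hg, Measure.map_map (hf.prodMap hg) (hX.prodMk hY),
    Measure.map_map hf hX, Measure.map_map hg hY]
  have h1' : μ.map (f ∘ X) = μ.map (g ∘ Y) := Measure.map_congr hfg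
  have h2 : μ.map (Prod.map f g ∘ fun ω => (X ω, Y ω)) =
      (μ.map (g ∘ Y)).map fun b => (b, b) := by
    rw [Measure.map_map .of_discrete (hg.comp hY)]
    refine Measure.map_congr ?_
    filter_upwards [hfg] with ω hω
    simp [hω]
  rw [h1', h2]
  have ht : (μ.map (g ∘ Y)) {true} = ENNReal.ofReal e := by
    rw [Measure.map_apply (hg.comp hY) (by simp), ← he]
    rfl
  refine binEntropy_le_klDiv_diag h0 h1 _ ht ?_
  have : ({false} : Set Bool) = {true}ᶜ := by ext; simp
  rw [this, prob_compl_eq_one_sub (by simp), ht, ENNReal.ofReal_sub _ h0.le, ENNReal.ofReal_one]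

/-! ### Satisficing Thompson sampling as a sequential search -/

/-- The actions tried by the agent as long as none of them is satisfactory. -/
def searchOrder {Ξ : Type*} (fresh : ∀ t, (Fin t → ℕ) × Ξ → ℕ) (z : Ξ) (t : ℕ) : ℕ :=
  fresh t (fun k : Fin t => searchOrder fresh z k, z)
termination_by t
decreasing_by exact k.2

lemma searchOrder_injective {Ξ : Type*} {fresh : ∀ t, (Fin t → ℕ) × Ξ → ℕ}
    (hf : ∀ t past x, ∀ k : Fin t, fresh t (past, x) ≠ past k) (z : Ξ) :
    Function.Injective (searchOrder fresh z) := by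
  have hne : ∀ {i j}, i < j → searchOrder fresh z j ≠ searchOrder fresh z i := by
    intro i j hij
    rw [searchOrder.eq_1 fresh z j]
    exact hf j (fun k => searchOrder fresh z k) z ⟨i, hij⟩
  intro i j h
  by_contra hij
  rcases lt_or_gt_of_ne hij with h' | h'
  · exact hne h' h.symm
  · exact hne h' h

/-- The agent tries the actions `b ξ 0, b ξ 1, …` in this order, and plays the first one whose
reward is at least `1 - ε` ever after. -/
structure IsSequentialSearch {Ω Ξ : Type*} [MeasurableSpace Ω] [MeasurableSpace Ξ]
    (μ : Measure Ω) (θ : ℕ → Ω → ℝ) (ξ : Ω → Ξ) (ε : ℝ) (A : ℕ → Ω → ℕ) (b : Ξ → ℕ → ℕ) :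
    Prop where
  measurable_reward : ∀ a, Measurable (θ a)
  measurable_exogenous : Measurable ξ
  measurable_action : ∀ t, Measurable (A t)
  measurable_order : ∀ k, Measurable fun z => b z k
  injective_order : ∀ z, Function.Injective (b z)
  law : μ.map (fun ω => (ξ ω, fun k => θ (b (ξ ω) k) ω)) = (μ.map ξ).prod rewardLaw
  action_eq : ∀ᵐ ω ∂μ, ∀ t, A t ω = b (ξ ω) (min t (hittingTime ε fun k => θ (b (ξ ω) k) ω))

/-! ### Measurability of the search, and the law of the rewards. -/

variable {Ω Ξ : Type*} [MeasurableSpace Ω] [MeasurableSpace Ξ]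

lemma measurable_apply_index {f : ℕ → Ω → ℝ} (hf : ∀ a, Measurable (f a)) {N : Ω → ℕ}
    (hN : Measurable N) : Measurable fun ω => f (N ω) ω :=
  (measurable_from_prod_countable_right (f := fun p : ℕ × Ω => f p.1 p.2) hf).comp
    (hN.prodMk measurable_id)

lemma measurable_index_apply {β : Type*} [MeasurableSpace β] {f : Ω → ℕ → β}
    (hf : ∀ a, Measurable fun ω => f ω a) {N : Ω → ℕ}
    (hN : Measurable N) : Measurable fun ω => f ω (N ω) :=
  (measurable_from_prod_countable_right (f := fun p : ℕ × Ω => f p.2 p.1) hf).comp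
    (hN.prodMk measurable_id)

lemma measurable_history {θ : ℕ → Ω → ℝ} (hθ : ∀ a, Measurable (θ a)) {A : ℕ → Ω → ℕ} {t : ℕ}
    (hA : ∀ k < t, Measurable (A k)) : Measurable (history θ A t) :=
  measurable_pi_iff.2 fun k => (hA k k.2).prodMk (measurable_apply_index hθ (hA k k.2))

lemma measurable_searchOrder {fresh : ∀ t, (Fin t → ℕ) × Ξ → ℕ}
    (hf : ∀ t, Measurable (fresh t)) (k : ℕ) : Measurable fun z => searchOrder fresh z k := by
  induction k using Nat.strong_induction_on with
  | _ k ih =>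
    simp_rw [fun z => searchOrder.eq_1 fresh z k]
    exact (hf k).comp ((measurable_pi_iff.2 fun j : Fin k => ih j j.2).prodMk measurable_id)

/-- Almost surely the sequence enters `[1 - 1/(n+1), 1]` for all `n` at once. -/
lemma ae_iSup_rewardLaw : ∀ᵐ x ∂rewardLaw, ⨆ a, x a = 1 := by
  have h : ∀ᵐ x ∂rewardLaw, ∀ n : ℕ, ∃ t, 1 - 1 / ((n : ℝ) + 1) ≤ x t :=
    ae_all_iff.2 fun n => ae_exists_le (by positivity)
  filter_upwards [h, ae_mem_Icc_rewardLaw] with x hx hx1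
  have hbdd : BddAbove (Set.range x) := ⟨1, by rintro _ ⟨k, rfl⟩; exact (hx1 k).2⟩
  refine le_antisymm (ciSup_le fun k => (hx1 k).2) (le_of_forall_pos_sub_le fun δ hδ => ?_)
  obtain ⟨n, hn⟩ := exists_nat_one_div_lt hδ
  obtain ⟨t, ht⟩ := hx n
  exact le_trans (by linarith) (ht.trans (le_ciSup hbdd t))

variable {μ : Measure Ω} {θ : ℕ → Ω → ℝ} {ξ : Ω → Ξ}

namespace IsDeterministicBandit

lemma map_reward (hB : IsDeterministicBandit μ θ ξ) : μ.map (fun ω a => θ a ω) = rewardLaw := by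
  rw [hB.indep.map_fun_eq_infinitePi_map hB.measurable_reward, rewardLaw]
  congr 1
  funext a
  exact hB.uniform a

lemma ae_of_ae_rewardLaw (hB : IsDeterministicBandit μ θ ξ) {p : (ℕ → ℝ) → Prop}
    (h : ∀ᵐ x ∂rewardLaw, p x) : ∀ᵐ ω ∂μ, p fun a => θ a ω := by
  rw [← hB.map_reward] at h
  exact ae_of_ae_map (measurable_pi_iff.2 hB.measurable_reward).aemeasurable h

lemma ae_optReward (hB : IsDeterministicBandit μ θ ξ) : ∀ᵐ ω ∂μ, optReward θ ω = 1 :=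
  hB.ae_of_ae_rewardLaw ae_iSup_rewardLaw

variable [IsProbabilityMeasure μ]

lemma map_exogenous_reward (hB : IsDeterministicBandit μ θ ξ) :
    μ.map (fun ω => (ξ ω, fun a => θ a ω)) = (μ.map ξ).prod rewardLaw := by
  rw [← hB.map_reward]
  exact (indepFun_iff_map_prod_eq_prod_map_map hB.measurable_exogenous.aemeasurable
    (measurable_pi_iff.2 hB.measurable_reward).aemeasurable).1 hB.indep_exogenous

/-- For each fixed value `z` of `ξ`, reindexing by the injection `b z` preserves the product law.
The skew product over `ξ` therefore preserves the joint law. -/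
lemma map_exogenous_reorder (hB : IsDeterministicBandit μ θ ξ) {b : Ξ → ℕ → ℕ}
    (hb : ∀ k, Measurable fun z => b z k) (hinj : ∀ z, Function.Injective (b z)) :
    μ.map (fun ω => (ξ ω, fun k => θ (b (ξ ω) k) ω)) = (μ.map ξ).prod rewardLaw := by
  have hm : Measurable (Function.uncurry fun (z : Ξ) (x : ℕ → ℝ) (k : ℕ) => x (b z k)) :=
    measurable_pi_iff.2 fun k => measurable_index_apply (f := fun p : Ξ × (ℕ → ℝ) => p.2)
      (fun a => (measurable_pi_apply a).comp measurable_snd) ((hb k).comp measurable_fst)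
  have := ((MeasurePreserving.id (μ.map ξ)).skew_product hm
    (Filter.Eventually.of_forall fun z => map_comp_rewardLaw (hinj z))).map_eq
  nth_rewrite 1 [← hB.map_exogenous_reward] at this
  rw [Measure.map_map] at this
  · exact this
  · exact measurable_fst.prodMk hm
  · exact hB.measurable_exogenous.prodMk (measurable_pi_iff.2 hB.measurable_reward)

end IsDeterministicBandit

section

variable [IsProbabilityMeasure μ]

/-- A model drawn from the posterior distribution given the history almost surely has supremum `1`
and agrees with the true model on the actions played so far. -/
lemma ae_sample_eq (hB : IsDeterministicBandit μ θ ξ) {A : ℕ → Ω → ℕ} {t : ℕ}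
    (hA : ∀ k < t, Measurable (A k)) {S : Ω → ℕ → ℝ} (hS : Measurable S)
    (h : condDistrib S (history θ A t) μ =ᵐ[μ.map (history θ A t)]
      condDistrib (fun ω a => θ a ω) (history θ A t) μ) :
    ∀ᵐ ω ∂μ, ⨆ a, S ω a = 1 ∧ ∀ k < t, S ω (A k ω) = θ (A k ω) ω := by
  have hH := measurable_history hB.measurable_reward hA
  have hθ : Measurable fun ω a => θ a ω := measurable_pi_iff.2 hB.measurable_reward
  -- Equal conditional laws given the history give equal joint laws with it. An almost sure relation
  -- between the history and `θ` then transfers to the sample.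
  have hlaw : μ.map (fun ω => (history θ A t ω, S ω)) =
      μ.map fun ω => (history θ A t ω, fun a => θ a ω) := by
    rw [← compProd_map_condDistrib hS.aemeasurable, ← compProd_map_condDistrib hθ.aemeasurable]
    exact Measure.compProd_congr h
  have hset : MeasurableSet {p : History t × (ℕ → ℝ) |
      ⨆ a, p.2 a = 1 ∧ ∀ k, p.2 (p.1 k).1 = (p.1 k).2} := by
    refine MeasurableSet.inter (s₁ := {p : History t × (ℕ → ℝ) | ⨆ a, p.2 a = 1})
      (s₂ := {p : History t × (ℕ → ℝ) | ∀ k, p.2 (p.1 k).1 = (p.1 k).2}) ?_ ?_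
    · exact measurableSet_eq_fun (.iSup fun a => (measurable_pi_apply a).comp measurable_snd)
        measurable_const
    · have : {p : History t × (ℕ → ℝ) | ∀ k, p.2 (p.1 k).1 = (p.1 k).2} =
          ⋂ k, {p | p.2 (p.1 k).1 = (p.1 k).2} := by ext; simp
      rw [this]
      refine MeasurableSet.iInter fun k => measurableSet_eq_fun ?_ (by fun_prop)
      exact measurable_index_apply (f := fun p : History t × (ℕ → ℝ) => p.2)
        (fun a => (measurable_pi_apply a).comp measurable_snd)
        (measurable_fst.comp ((measurable_pi_apply k).comp measurable_fst))
  have hae : ∀ᵐ p ∂(μ.map fun ω => (history θ A t ω, fun a => θ a ω)),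
      ⨆ a, p.2 a = 1 ∧ ∀ k, p.2 (p.1 k).1 = (p.1 k).2 := by
    rw [ae_map_iff (hH.prodMk hθ).aemeasurable hset]
    filter_upwards [hB.ae_optReward] with ω hω
    exact ⟨hω, fun k => rfl⟩
  rw [← hlaw, ae_map_iff (hH.prodMk hS).aemeasurable hset] at hae
  filter_upwards [hae] with ω hω
  exact ⟨hω.1, fun k hk => hω.2 ⟨k, hk⟩⟩

end

/-- If the sampled model agrees with the true one on past actions, the rule of satisficing Thompson
sampling plays `b 0, b 1, …` up to the first satisfactory action and then sticks to it. -/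
lemma eq_min_hittingTime {ε : ℝ} {a b : ℕ → ℕ} {r : ℕ → ℝ} (hex : ∃ k, 1 - ε ≤ r (b k))
    (hold : ∀ t, ∀ k < t, 1 - ε ≤ r (a k) → (∀ j < k, ¬ 1 - ε ≤ r (a j)) → a t = a k)
    (hnew : ∀ t, (∀ k < t, ¬ 1 - ε ≤ r (a k)) → (∀ k < t, a k = b k) → a t = b t) (t : ℕ) :
    a t = b (min t (hittingTime ε fun k => r (b k))) := by
  set σ := hittingTime ε fun k => r (b k) with hσ
  have hσ1 : 1 - ε ≤ r (b σ) := le_hittingTime (x := fun k => r (b k)) hex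
  have hlt : ∀ k < σ, ¬ 1 - ε ≤ r (b k) := fun k hk =>
    not_le.2 (lt_of_lt_hittingTime (x := fun k => r (b k)) hk)
  induction t using Nat.strong_induction_on with
  | _ t ih =>
    rcases lt_or_ge σ t with h | h
    · rw [min_eq_right h.le, hold t σ h, ih σ h, min_self]
      · rw [ih σ h, min_self]; exact hσ1
      · intro j hj
        rw [ih j (hj.trans h), min_eq_left hj.le]
        exact hlt j hj
    · rw [min_eq_left h]
      have heq : ∀ k < t, a k = b k := fun k hk => by
        rw [ih k hk, min_eq_left (hk.le.trans h)]
      exact hnew t (fun k hk => by rw [heq k hk]; exact hlt k (hk.trans_le h)) heq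

/-- Measurability of the actions is no part of `IsSTS`. It follows by strong induction, since the
rule at time `t` is a countable case distinction on earlier actions, the sample and `ξ`. -/
lemma measurable_action_of_rule {ε : ℝ} {A : ℕ → Ω → ℕ}
    (hθ : ∀ a, Measurable (θ a)) (hξ : Measurable ξ)
    {sample : ∀ t, History t × Ξ → ℕ → ℝ} {fresh : ∀ t, (Fin t → ℕ) × Ξ → ℕ}
    (hs : ∀ t, Measurable (sample t)) (hf : ∀ t, Measurable (fresh t))
    (hold : ∀ t ω, ∀ k < t,
      Satisfactory ε A (sample t (history θ A t ω, ξ ω)) ω k →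
      (∀ j < k, ¬ Satisfactory ε A (sample t (history θ A t ω, ξ ω)) ω j) →
      A t ω = A k ω)
    (hnew : ∀ t ω,
      (∀ k < t, ¬ Satisfactory ε A (sample t (history θ A t ω, ξ ω)) ω k) →
      A t ω = fresh t (fun k => A k ω, ξ ω)) (t : ℕ) : Measurable (A t) := by
  induction t using Nat.strong_induction_on with
  | _ t ih =>
    have hS : Measurable fun ω => sample t (history θ A t ω, ξ ω) :=
      (hs t).comp ((measurable_history hθ ih).prodMk hξ)
    have hsat : ∀ k < t,
        MeasurableSet {ω | Satisfactory ε A (sample t (history θ A t ω, ξ ω)) ω k} := by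
      intro k hk
      refine measurableSet_le (.iSup fun a => (measurable_pi_apply a).comp hS) ?_
      exact (measurable_index_apply (fun a => (measurable_pi_apply a).comp hS)
        (ih k hk)).add_const ε
    have hg : Measurable fun ω => fresh t (fun k => A k ω, ξ ω) :=
      (hf t).comp ((measurable_pi_iff.2 fun k : Fin t => ih k k.2).prodMk hξ)
    have hA : ∀ a, A t ⁻¹' {a} =
        (⋃ k, ⋃ (_ : k < t), {ω | Satisfactory ε A (sample t (history θ A t ω, ξ ω)) ω k} ∩
          (⋂ j, ⋂ (_ : j < k), {ω | Satisfactory ε A (sample t (history θ A t ω, ξ ω)) ω j}ᶜ) ∩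
          A k ⁻¹' {a}) ∪
        ((⋂ k, ⋂ (_ : k < t), {ω | Satisfactory ε A (sample t (history θ A t ω, ξ ω)) ω k}ᶜ) ∩
          (fun ω => fresh t (fun k => A k ω, ξ ω)) ⁻¹' {a}) := by
      intro a
      ext ω
      simp only [Set.mem_preimage, Set.mem_singleton_iff, Set.mem_union, Set.mem_iUnion,
        Set.mem_inter_iff, Set.mem_iInter, Set.mem_compl_iff, Set.mem_ofPred_eq, exists_prop]
      constructor
      · intro ha
        by_cases h : ∃ k, k < t ∧ Satisfactory ε A (sample t (history θ A t ω, ξ ω)) ω k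
        · classical
          obtain ⟨hk, hks⟩ := Nat.find_spec h
          have hmin : ∀ j < Nat.find h,
              ¬ Satisfactory ε A (sample t (history θ A t ω, ξ ω)) ω j :=
            fun j hj hs => Nat.find_min h hj ⟨hj.trans hk, hs⟩
          exact Or.inl ⟨Nat.find h, hk, ⟨hks, hmin⟩, by rw [← hold t ω _ hk hks hmin, ha]⟩
        · have h' : ∀ k < t, ¬ Satisfactory ε A (sample t (history θ A t ω, ξ ω)) ω k :=
            fun k hk hs => h ⟨k, hk, hs⟩
          exact Or.inr ⟨h', by rw [← hnew t ω h', ha]⟩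
      · rintro (⟨k, hk, ⟨hks, hmin⟩, ha⟩ | ⟨h, ha⟩)
        · rw [hold t ω k hk hks hmin, ha]
        · rw [hnew t ω h, ha]
    refine measurable_to_countable' fun a => ?_
    rw [hA a]
    refine MeasurableSet.union (MeasurableSet.iUnion fun k => MeasurableSet.iUnion fun hk => ?_)
      (MeasurableSet.inter (MeasurableSet.iInter fun k => MeasurableSet.iInter fun hk =>
        (hsat k hk).compl) (hg (by simp)))
    exact ((hsat k hk).inter (MeasurableSet.iInter fun j => MeasurableSet.iInter fun hj =>
      (hsat j (hj.trans hk)).compl)).inter (ih k hk (by simp))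

/-- Satisficing Thompson sampling is a sequential search. -/
theorem IsSTS.exists_isSequentialSearch [IsProbabilityMeasure μ]
    (hB : IsDeterministicBandit μ θ ξ) {ε : ℝ} (h0 : 0 < ε)
    {A : ℕ → Ω → ℕ} (hA : IsSTS μ θ ξ ε A) :
    ∃ b : Ξ → ℕ → ℕ, IsSequentialSearch μ θ ξ ε A b := by
  obtain ⟨sample, fresh, hs, hf, hne, hpost, hold, hnew⟩ := hA
  have hm := measurable_action_of_rule hB.measurable_reward hB.measurable_exogenous hs hf hold hnew
  have hb := measurable_searchOrder hf
  have hinj := searchOrder_injective hne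
  have hlaw := hB.map_exogenous_reorder hb hinj
  have hX : Measurable fun ω => (ξ ω, fun k => θ (searchOrder fresh (ξ ω) k) ω) :=
    hB.measurable_exogenous.prodMk (measurable_pi_iff.2 fun k =>
      measurable_apply_index hB.measurable_reward ((hb k).comp hB.measurable_exogenous))
  refine ⟨searchOrder fresh, hB.measurable_reward, hB.measurable_exogenous, hm, hb, hinj, hlaw, ?_⟩
  have hex : ∀ᵐ ω ∂μ, ∃ k, 1 - ε ≤ θ (searchOrder fresh (ξ ω) k) ω := by
    have h1 : ∀ᵐ p ∂(μ.map ξ).prod rewardLaw, ∃ k, 1 - ε ≤ p.2 k :=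
      Measure.quasiMeasurePreserving_snd.ae (ae_exists_le h0)
    rw [← hlaw] at h1
    exact ae_of_ae_map hX.aemeasurable h1
  have hsample := ae_all_iff.2 fun t => ae_sample_eq hB (t := t) (fun k _ => hm k)
    ((hs t).comp ((measurable_history hB.measurable_reward fun k _ => hm k).prodMk
      hB.measurable_exogenous)) (hpost t)
  filter_upwards [hex, hsample] with ω hω hS t
  -- The sampled supremum is `1` and the sample is exact on played arms, so the test on the sample
  -- is a test on the true reward.
  have hiff : ∀ t, ∀ k < t,
      (Satisfactory ε A (sample t (history θ A t ω, ξ ω)) ω k ↔ 1 - ε ≤ θ (A k ω) ω) := by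
    intro t k hk
    have h1 := (hS t).1
    have h2 := (hS t).2 k hk
    simp only [Function.comp_apply] at h1 h2
    rw [Satisfactory, h1, h2, sub_le_iff_le_add]
  refine eq_min_hittingTime (a := fun k => A k ω) (b := searchOrder fresh (ξ ω))
    (r := fun a => θ a ω) hω ?_ ?_ t
  · intro t k hk hk1 hmin
    exact hold t ω k hk ((hiff t k hk).2 hk1) fun j hj =>
      mt (hiff t j (hj.trans hk)).1 (hmin j hj)
  · intro t hno heq
    rw [hnew t ω fun k hk => mt (hiff t k hk).1 (hno k hk), searchOrder.eq_1]
    congr 2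
    funext k
    exact heq k k.2

/-! ### Conditional distributions of functions of independent variables -/

section Kernels

variable {Ω U V T Z : Type*} [MeasurableSpace Ω] [MeasurableSpace U] [MeasurableSpace V]
  [MeasurableSpace T] [MeasurableSpace Z]

/-- The kernel sending `u` to the law of `g (u, V)`, where `V` has law `ν`. -/
def sectionKernel (ν : Measure V) (g : U × V → T) : Kernel U T :=
  (Kernel.id ×ₖ Kernel.const U ν).map g

lemma sectionKernel_apply (ν : Measure V) [SFinite ν] {g : U × V → T} (hg : Measurable g) (u : U) :
    sectionKernel ν g u = ν.map fun v => g (u, v) := by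
  rw [sectionKernel, Kernel.map_apply _ hg, Kernel.prod_apply, Kernel.id_apply, Kernel.const_apply,
    Measure.dirac_prod, Measure.map_map hg measurable_prodMk_left]
  rfl

lemma isMarkovKernel_sectionKernel (ν : Measure V) [IsProbabilityMeasure ν] {g : U × V → T}
    (hg : Measurable g) : IsMarkovKernel (sectionKernel ν g) :=
  Kernel.IsMarkovKernel.map _ hg

variable {μ : Measure Ω} {ν : Measure V} [IsProbabilityMeasure ν]

lemma map_prodMk_comp_left {X : Ω → U} {Y : Ω → V} (hX : Measurable X) (hY : Measurable Y)
    {m : Measure U} [IsProbabilityMeasure m] (h : μ.map (fun ω => (X ω, Y ω)) = m.prod ν)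
    {f : U → T} (hf : Measurable f) :
    μ.map (fun ω => (f (X ω), Y ω)) = (μ.map fun ω => f (X ω)).prod ν := by
  have hm : μ.map X = m := by
    rw [← Measure.fst_map_prodMk hY, h, Measure.fst_prod]
  have h1 : μ.map (fun ω => f (X ω)) = m.map f := by
    rw [← hm, Measure.map_map hf hX]; rfl
  have h2 : μ.map (fun ω => (f (X ω), Y ω)) =
      (μ.map fun ω => (X ω, Y ω)).map (Prod.map f id) := by
    rw [Measure.map_map (hf.prodMap measurable_id) (hX.prodMk hY)]; rfl
  rw [h1, h2, h, ← Measure.map_prod_map _ _ hf measurable_id, Measure.map_id]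

variable [IsProbabilityMeasure μ]

lemma map_prodMk_eq_compProd_sectionKernel {X : Ω → U} {Y : Ω → V} (hX : Measurable X)
    (hY : Measurable Y) (h : μ.map (fun ω => (X ω, Y ω)) = (μ.map X).prod ν)
    {g : U × V → T} (hg : Measurable g) :
    μ.map (fun ω => (X ω, g (X ω, Y ω))) = μ.map X ⊗ₘ sectionKernel ν g := by
  have := isMarkovKernel_sectionKernel ν hg
  have := Measure.isProbabilityMeasure_map (μ := μ) hX.aemeasurable
  have h2 : μ.map (fun ω => (X ω, g (X ω, Y ω))) =
      ((μ.map X).prod ν).map fun p => (p.1, g p) := by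
    rw [← h, Measure.map_map (measurable_fst.prodMk hg) (hX.prodMk hY)]; rfl
  rw [h2]
  refine Measure.ext_of_lintegral _ fun f hf => ?_
  rw [Measure.lintegral_compProd hf, lintegral_map hf (measurable_fst.prodMk hg),
    lintegral_prod (fun p => f (p.1, g p)) (hf.comp (measurable_fst.prodMk hg)).aemeasurable]
  refine lintegral_congr fun u => ?_
  rw [sectionKernel_apply ν hg, lintegral_map (by fun_prop) (by fun_prop)]

/-- Since `Y` is independent of the pair `(F, X)`, conditioning on `F` changes the law of `X` only;
given `X = z`, the second coordinate keeps the law of `g (z, Y)`. -/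
lemma condDistrib_prodMk_ae_eq {F : Ω → U} {X : Ω → Z} {Y : Ω → V} (hF : Measurable F)
    [StandardBorelSpace Z] [Nonempty Z] [StandardBorelSpace T] [Nonempty T]
    (hX : Measurable X) (hY : Measurable Y)
    (h : μ.map (fun ω => ((F ω, X ω), Y ω)) = (μ.map fun ω => (F ω, X ω)).prod ν)
    {g : Z × V → T} (hg : Measurable g) :
    ∀ᵐ u ∂μ.map F, condDistrib (fun ω => (X ω, g (X ω, Y ω))) F μ u =
      condDistrib X F μ u ⊗ₘ sectionKernel ν g := by
  have hK := isMarkovKernel_sectionKernel ν hg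
  have := Measure.isProbabilityMeasure_map (μ := μ) hF.aemeasurable
  have hFX := hF.prodMk hX
  have key : μ.map (fun ω => (F ω, (X ω, g (X ω, Y ω)))) =
      μ.map F ⊗ₘ (condDistrib X F μ ⊗ₖ Kernel.prodMkLeft U (sectionKernel ν g)) := by
    refine Measure.ext_of_lintegral _ fun f hf => ?_
    have hg' : Measurable fun p : (U × Z) × V => g (p.1.2, p.2) := by fun_prop
    have h1 := map_prodMk_eq_compProd_sectionKernel hFX hY h hg'
    have h2 : μ.map (fun ω => (F ω, (X ω, g (X ω, Y ω)))) =
        (μ.map fun ω => ((F ω, X ω), g (X ω, Y ω))).map fun p => (p.1.1, (p.1.2, p.2)) := by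
      rw [Measure.map_map (by fun_prop) (by fun_prop)]; rfl
    have := isMarkovKernel_sectionKernel ν hg'
    rw [h2, h1, lintegral_map hf (by fun_prop), Measure.lintegral_compProd (by fun_prop),
      ← compProd_map_condDistrib hX.aemeasurable, Measure.lintegral_compProd,
      Measure.lintegral_compProd hf]
    · refine lintegral_congr fun u => ?_
      rw [Kernel.lintegral_compProd _ _ _ (by fun_prop)]
      refine lintegral_congr fun z => ?_
      rw [Kernel.prodMkLeft_apply, sectionKernel_apply ν hg, sectionKernel_apply ν hg']
    · have : Measurable fun p : (U × Z) × T => f (p.1.1, (p.1.2, p.2)) := by fun_prop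
      exact this.lintegral_kernel_prod_right'
  have hW : Measurable fun ω => (X ω, g (X ω, Y ω)) := by fun_prop
  filter_upwards [condDistrib_ae_eq_of_measure_eq_compProd F hW.aemeasurable key] with u hu
  rw [hu, Kernel.compProd_apply_eq_compProd_sectR]
  rfl

/-- Conditional distributions agree on an event of the conditioning variable on which both the
conditioning and the conditioned variables agree. -/
lemma condDistrib_ae_eq_of_agree [StandardBorelSpace T] [Nonempty T]
    [MeasurableSpace.CountablyGenerated U] {F F' : Ω → U} {W W' : Ω → T} (hF : Measurable F)
    (hF' : Measurable F') (hW : Measurable W) (hW' : Measurable W') {N : Set U}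
    (hN : MeasurableSet N) (hmem : ∀ᵐ ω ∂μ, F ω ∈ N ↔ F' ω ∈ N)
    (hagree : ∀ᵐ ω ∂μ, F ω ∈ N → F ω = F' ω ∧ W ω = W' ω) :
    ∀ᵐ ω ∂μ, F ω ∈ N → condDistrib W F μ (F ω) = condDistrib W' F' μ (F ω) := by
  -- Restricting a joint law to `G ∈ N` leaves its disintegrating kernel unchanged. The two
  -- restricted joint laws coincide, and uniqueness of the disintegration concludes.
  have hr : ∀ {G : Ω → U} {R : Ω → T}, Measurable G → Measurable R →
      (μ.map G).restrict N ⊗ₘ condDistrib R G μ =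
        (μ.restrict (G ⁻¹' N)).map fun ω => (G ω, R ω) := by
    intro G R hG hR
    have : (fun ω => (G ω, R ω)) ⁻¹' (N ×ˢ Set.univ) = G ⁻¹' N := by ext; simp
    rw [← this, ← Measure.restrict_map (hG.prodMk hR) (hN.prod .univ),
      ← compProd_map_condDistrib hR.aemeasurable]
    ext s hs
    rw [Measure.compProd_apply hs, Measure.restrict_apply hs,
      Measure.compProd_apply (hs.inter (hN.prod .univ)), ← lintegral_indicator hN]
    refine lintegral_congr fun u => ?_
    by_cases hu : u ∈ N <;> simp [hu, Set.preimage]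
  have hset : F ⁻¹' N =ᵐ[μ] F' ⁻¹' N := by
    filter_upwards [hmem] with ω hω
    exact propext hω
  have hrestr : μ.restrict (F ⁻¹' N) = μ.restrict (F' ⁻¹' N) := Measure.restrict_congr_set hset
  have hagree' := (ae_restrict_iff' (hF hN)).2 hagree
  have hm : (μ.map F).restrict N = (μ.map F').restrict N := by
    rw [Measure.restrict_map hF hN, Measure.restrict_map hF' hN, ← hrestr]
    exact Measure.map_congr (hagree'.mono fun ω hω => hω.1)
  have hcomp : (μ.map F).restrict N ⊗ₘ condDistrib W F μ =
      (μ.map F).restrict N ⊗ₘ condDistrib W' F' μ := by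
    rw [hr hF hW, hm, hr hF' hW', ← hrestr]
    exact Measure.map_congr (hagree'.mono fun ω hω => Prod.ext hω.1 hω.2)
  have := Kernel.ae_eq_of_compProd_eq hcomp
  rw [Filter.EventuallyEq, ae_restrict_iff' hN] at this
  exact ae_of_ae_map hF.aemeasurable this

end Kernels

/-- The canonical `condKernel` agrees almost everywhere with any given disintegration `K`, so a
pointwise bound along `K` suffices. -/
lemma le_condMutualInfoOfLaw {S T Z : Type*} [MeasurableSpace S] [StandardBorelSpace S] [Nonempty S]
    [MeasurableSpace T] [StandardBorelSpace T] [Nonempty T] [MeasurableSpace Z]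
    {ρ : Measure (Z × (S × T))} [IsFiniteMeasure ρ] {Q : Measure Z} [IsProbabilityMeasure Q]
    {K : Kernel Z (S × T)} [IsMarkovKernel K] (hρ : ρ = Q ⊗ₘ K) {c : ℝ≥0∞}
    (hc : ∀ z, c ≤ InformationTheory.klDiv (K z) ((K z).fst.prod (K z).snd)) :
    c ≤ condMutualInfoOfLaw ρ := by
  subst hρ
  rw [condMutualInfoOfLaw, Measure.fst_compProd]
  calc c = ∫⁻ _, c ∂Q := by simp
    _ ≤ ∫⁻ z, InformationTheory.klDiv (K z) ((K z).fst.prod (K z).snd) ∂Q := lintegral_mono hc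
    _ = _ := by
      refine lintegral_congr_ae ?_
      filter_upwards [condKernel_compProd Q K] with z hz
      rw [hz]

/-! ### Analysis of the sequential search -/

/-- The rewards of the actions `b ξ 0, b ξ 1, …`. -/
def orderedReward {Ω Ξ : Type*} (θ : ℕ → Ω → ℝ) (ξ : Ω → Ξ) (b : Ξ → ℕ → ℕ) (ω : Ω) : ℕ → ℝ :=
  fun k => θ (b (ξ ω) k) ω

/-- The history of an agent who tries the actions `b ξ 0, b ξ 1, …` whatever their rewards. -/
def searchHistory {Ω Ξ : Type*} (θ : ℕ → Ω → ℝ) (ξ : Ω → Ξ) (b : Ξ → ℕ → ℕ) (t : ℕ) (ω : Ω) :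
    History t :=
  fun k => (b (ξ ω) k, orderedReward θ ξ b ω k)

/-- Histories without a satisfactory action. -/
def unsatisfactoryHistories (ε : ℝ) (t : ℕ) : Set (History t) := {h | ∀ k, (h k).2 < 1 - ε}

/-- The excess of the first satisfactory reward over the first one. -/
def searchGain (ε : ℝ) (x : ℕ → ℝ) : ℝ := x (hittingTime ε x) - x 0

lemma measurableSet_unsatisfactoryHistories (ε : ℝ) (t : ℕ) :
    MeasurableSet (unsatisfactoryHistories ε t) := by
  have : unsatisfactoryHistories ε t = ⋂ k, {h | (h k).2 < 1 - ε} := by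
    ext; simp [unsatisfactoryHistories]
  rw [this]
  exact MeasurableSet.iInter fun k => measurableSet_lt (by fun_prop) measurable_const

lemma measurable_searchGain (ε : ℝ) : Measurable (searchGain ε) :=
  (measurable_index_apply (f := fun x : ℕ → ℝ => x) measurable_pi_apply
    (measurable_hittingTime ε)).sub (measurable_pi_apply 0)

lemma ae_searchGain_mem {ε : ℝ} (h0 : 0 < ε) :
    ∀ᵐ x ∂rewardLaw, 0 ≤ searchGain ε x ∧ searchGain ε x ≤ 1 - x 0 := by
  filter_upwards [ae_exists_le h0, ae_mem_Icc_rewardLaw] with x hx hx1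
  refine ⟨?_, by unfold searchGain; linarith [(hx1 (hittingTime ε x)).2]⟩
  unfold searchGain
  rcases Nat.eq_zero_or_pos (hittingTime ε x) with h | h
  · rw [h, sub_self]
  · linarith [le_hittingTime hx, lt_of_lt_hittingTime h]

lemma integrable_searchGain {ε : ℝ} (h0 : 0 < ε) : Integrable (searchGain ε) rewardLaw := by
  refine Integrable.of_bound (C := 1) (measurable_searchGain ε).aestronglyMeasurable ?_
  filter_upwards [ae_searchGain_mem h0, ae_mem_Icc_rewardLaw] with x hx hx1
  rw [Real.norm_of_nonneg hx.1]
  linarith [(hx1 0).1]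

/-- The gain lies between `0` and `1 - x 0`, whose mean is `1/2`. -/
lemma integral_searchGain_mem {ε : ℝ} (h0 : 0 < ε) :
    ∫ x, searchGain ε x ∂rewardLaw ∈ Set.Icc 0 (1 / 2 : ℝ) := by
  constructor
  · exact integral_nonneg_of_ae ((ae_searchGain_mem h0).mono fun x hx => hx.1)
  · calc ∫ x, searchGain ε x ∂rewardLaw ≤ ∫ x : ℕ → ℝ, (1 - x 0) ∂rewardLaw :=
          integral_mono_ae (integrable_searchGain h0)
            ((integrable_const _).sub (integrable_eval_rewardLaw 0))
            ((ae_searchGain_mem h0).mono fun x hx => hx.2)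
      _ = 1 / 2 := by
          rw [integral_sub (integrable_const _) (integrable_eval_rewardLaw 0),
            integral_eval_rewardLaw]
          norm_num

namespace IsSequentialSearch

variable {Ω Ξ : Type*} [MeasurableSpace Ω] [MeasurableSpace Ξ] {μ : Measure Ω}
  {θ : ℕ → Ω → ℝ} {ξ : Ω → Ξ} {ε : ℝ} {A : ℕ → Ω → ℕ} {b : Ξ → ℕ → ℕ}

lemma measurable_orderedReward (h : IsSequentialSearch μ θ ξ ε A b) :
    Measurable (orderedReward θ ξ b) :=
  measurable_pi_iff.2 fun k => measurable_apply_index h.measurable_reward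
    ((h.measurable_order k).comp h.measurable_exogenous)

lemma measurable_searchHistory (h : IsSequentialSearch μ θ ξ ε A b) (t : ℕ) :
    Measurable (searchHistory θ ξ b t) :=
  measurable_pi_iff.2 fun k => ((h.measurable_order k).comp h.measurable_exogenous).prodMk
    ((measurable_pi_apply (k : ℕ)).comp h.measurable_orderedReward)

lemma measurable_history (h : IsSequentialSearch μ θ ξ ε A b) (t : ℕ) :
    Measurable (history θ A t) :=
  SatisficingBandit.measurable_history h.measurable_reward fun k _ => h.measurable_action k

lemma measurable_reward_action (h : IsSequentialSearch μ θ ξ ε A b) (t : ℕ) :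
    Measurable fun ω => θ (A t ω) ω :=
  measurable_apply_index h.measurable_reward (h.measurable_action t)

lemma measurable_firstSatisfactory (h : IsSequentialSearch μ θ ξ ε A b) :
    Measurable (firstSatisfactory θ A ε) :=
  (measurable_hittingTime ε).comp (measurable_pi_iff.2 h.measurable_reward_action)

lemma measurable_benchmark (h : IsSequentialSearch μ θ ξ ε A b) :
    Measurable (benchmark θ A ε) :=
  measurable_index_apply (f := fun ω t => A t ω) h.measurable_action
    h.measurable_firstSatisfactory

lemma ae_action_eq (h : IsSequentialSearch μ θ ξ ε A b) :
    ∀ᵐ ω ∂μ, ∀ t, A t ω = b (ξ ω) (min t (hittingTime ε (orderedReward θ ξ b ω))) ∧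
      θ (A t ω) ω =
        orderedReward θ ξ b ω (min t (hittingTime ε (orderedReward θ ξ b ω))) := by
  filter_upwards [h.action_eq] with ω hω t
  have := hω t
  exact ⟨this, by rw [this]; rfl⟩

variable [IsProbabilityMeasure μ]

lemma map_orderedReward (h : IsSequentialSearch μ θ ξ ε A b) :
    μ.map (orderedReward θ ξ b) = rewardLaw := by
  have := Measure.isProbabilityMeasure_map (μ := μ) h.measurable_exogenous.aemeasurable
  rw [← Measure.snd_map_prodMk (Y := orderedReward θ ξ b) h.measurable_exogenous]
  change (μ.map fun ω => (ξ ω, fun k => θ (b (ξ ω) k) ω)).snd = _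
  rw [h.law, Measure.snd_prod]

lemma ae_of_ae_rewardLaw (h : IsSequentialSearch μ θ ξ ε A b) {p : (ℕ → ℝ) → Prop}
    (hp : ∀ᵐ x ∂rewardLaw, p x) : ∀ᵐ ω ∂μ, p (orderedReward θ ξ b ω) := by
  rw [← h.map_orderedReward] at hp
  exact ae_of_ae_map h.measurable_orderedReward.aemeasurable hp

lemma ae_firstSatisfactory_eq (h : IsSequentialSearch μ θ ξ ε A b) (h0 : 0 < ε) :
    ∀ᵐ ω ∂μ, (1 - ε ≤ θ (A (hittingTime ε (orderedReward θ ξ b ω)) ω) ω) ∧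
      firstSatisfactory θ A ε ω = hittingTime ε (orderedReward θ ξ b ω) ∧
      benchmark θ A ε ω = b (ξ ω) (hittingTime ε (orderedReward θ ξ b ω)) := by
  filter_upwards [h.ae_action_eq, h.ae_of_ae_rewardLaw (ae_exists_le h0)] with ω hω hex
  have h1 : 1 - ε ≤ θ (A (hittingTime ε (orderedReward θ ξ b ω)) ω) ω := by
    rw [(hω _).2, min_self]
    exact le_hittingTime hex
  have h2 : firstSatisfactory θ A ε ω = hittingTime ε (orderedReward θ ξ b ω) := by
    refine (hittingTime_eq_iff (x := fun t => θ (A t ω) ω) ⟨_, h1⟩ _).2 ⟨h1, fun k hk => ?_⟩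
    rw [(hω k).2, min_eq_left hk.le]
    exact lt_of_lt_hittingTime hk
  refine ⟨h1, h2, ?_⟩
  rw [benchmark, h2, (hω _).1, min_self]

theorem map_firstSatisfactory {ε : unitInterval} (h : IsSequentialSearch μ θ ξ ε A b)
    (hε : (ε : ℝ) ∈ Set.Ioo (0 : ℝ) 1) :
    μ.map (firstSatisfactory θ A ε) = geometricMeasure ε := by
  rw [← map_hittingTime ε hε, ← h.map_orderedReward,
    Measure.map_map (measurable_hittingTime _) h.measurable_orderedReward]
  exact Measure.map_congr ((h.ae_firstSatisfactory_eq hε.1).mono fun ω hω => hω.2.1)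

theorem entropy_firstSatisfactory {ε : unitInterval} (h : IsSequentialSearch μ θ ξ ε A b)
    (hε : (ε : ℝ) ∈ Set.Ioo (0 : ℝ) 1) :
    entropy μ (firstSatisfactory θ A ε) = ENNReal.ofReal (Real.binEntropy ε / ε) := by
  rw [entropy, h.map_firstSatisfactory hε, entropyOfLaw_geometricMeasure ε hε]

/-- Given the internal randomness, the benchmark action is a one-to-one function of the time at
which it is found. -/
theorem condEntropy_benchmark {ε : unitInterval} (h : IsSequentialSearch μ θ ξ ε A b)
    (hε : (ε : ℝ) ∈ Set.Ioo (0 : ℝ) 1) :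
    condEntropy μ (benchmark θ A ε) ξ = entropy μ (firstSatisfactory θ A ε) := by
  have := Measure.isProbabilityMeasure_map (μ := μ) h.measurable_exogenous.aemeasurable
  have hg : Measurable fun p : Ξ × (ℕ → ℝ) => b p.1 (hittingTime ε p.2) :=
    measurable_index_apply (f := fun p : Ξ × (ℕ → ℝ) => b p.1)
      (fun k => (h.measurable_order k).comp measurable_fst)
      ((measurable_hittingTime ε).comp measurable_snd)
  have hK := isMarkovKernel_sectionKernel rewardLaw hg
  have hlaw := map_prodMk_eq_compProd_sectionKernel h.measurable_exogenous
    h.measurable_orderedReward h.law hg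
  have hcongr : μ.map (fun ω => (ξ ω, benchmark θ A ε ω)) =
      μ.map (fun ω => (ξ ω, b (ξ ω) (hittingTime ε (orderedReward θ ξ b ω)))) := by
    refine Measure.map_congr ?_
    filter_upwards [h.ae_firstSatisfactory_eq hε.1] with ω hω
    rw [hω.2.2]
  have hcd := condDistrib_ae_eq_of_measure_eq_compProd ξ h.measurable_benchmark.aemeasurable
    (hcongr.trans hlaw)
  rw [condEntropy, entropy, h.map_firstSatisfactory hε]
  calc ∫⁻ z, entropyOfLaw (condDistrib (benchmark θ A ε) ξ μ z) ∂μ.map ξ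
      = ∫⁻ _, entropyOfLaw (geometricMeasure ε) ∂μ.map ξ := by
        refine lintegral_congr_ae ?_
        filter_upwards [hcd] with z hz
        rw [hz, sectionKernel_apply _ hg, ← map_hittingTime ε hε,
          ← entropyOfLaw_map_of_injective (rewardLaw.map (hittingTime ε)) (h.injective_order z),
          Measure.map_map .of_discrete (measurable_hittingTime _)]
        rfl
    _ = _ := by simp

/-- The outcomes of later trials are independent of the history and the internal randomness. -/
lemma map_searchHistory_shift (h : IsSequentialSearch μ θ ξ ε A b) (t : ℕ) :
    μ.map (fun ω => ((searchHistory θ ξ b t ω, ξ ω), fun j => orderedReward θ ξ b ω (t + j))) =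
      (μ.map fun ω => (searchHistory θ ξ b t ω, ξ ω)).prod rewardLaw := by
  have := Measure.isProbabilityMeasure_map (μ := μ) h.measurable_exogenous.aemeasurable
  set νt := rewardLaw.map fun (x : ℕ → ℝ) (k : Fin t) => x k with hνt
  have : IsProbabilityMeasure νt :=
    Measure.isProbabilityMeasure_map (Measurable.aemeasurable (by fun_prop))
  -- The reward sequence is cut at `t`, and the product is reassociated so that `ξ` is grouped with
  -- the first `t` rewards, which together determine the search history.
  have e1 := ((MeasurePreserving.id (μ.map ξ)).prod (measurePreserving_split_rewardLaw t)).map_eq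
  have e2 := (measurePreserving_prodAssoc (μ.map ξ) νt rewardLaw).symm.map_eq
  have hX := h.measurable_orderedReward
  have hξ := h.measurable_exogenous
  have hsplit := (measurePreserving_split_rewardLaw t).measurable
  have hpair : Measurable fun ω => (ξ ω, orderedReward θ ξ b ω) := hξ.prodMk hX
  have hlaw : μ.map (fun ω => (ξ ω, orderedReward θ ξ b ω)) = (μ.map ξ).prod rewardLaw := h.law
  rw [← e1, ← hlaw, Measure.map_map (MeasurableEquiv.measurable _) (measurable_id.prodMap hsplit),
    Measure.map_map ((MeasurableEquiv.measurable _).comp (measurable_id.prodMap hsplit)) hpair]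
    at e2
  have hf : Measurable fun p : Ξ × (Fin t → ℝ) =>
      ((fun k : Fin t => (b p.1 k, p.2 k) : History t), p.1) :=
    (measurable_pi_iff.2 fun k : Fin t => ((h.measurable_order k).comp measurable_fst).prodMk
      ((measurable_pi_apply k).comp measurable_snd)).prodMk measurable_fst
  exact map_prodMk_comp_left
    (hξ.prodMk (measurable_pi_iff.2 fun k : Fin t => (measurable_pi_apply (k : ℕ)).comp hX))
    (measurable_pi_iff.2 fun j => (measurable_pi_apply (t + j)).comp hX) e2 hf

/-- As long as no satisfactory action has been found, the agent explores. -/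
lemma ae_exploration (h : IsSequentialSearch μ θ ξ ε A b) (h0 : 0 < ε) (t : ℕ) :
    ∀ᵐ ω ∂μ, (history θ A t ω ∈ unsatisfactoryHistories ε t ↔
        searchHistory θ ξ b t ω ∈ unsatisfactoryHistories ε t) ∧
      (history θ A t ω ∈ unsatisfactoryHistories ε t →
        history θ A t ω = searchHistory θ ξ b t ω ∧
        benchmark θ A ε ω =
          b (ξ ω) (t + hittingTime ε fun j => orderedReward θ ξ b ω (t + j)) ∧
        θ (A t ω) ω = orderedReward θ ξ b ω t ∧
        θ (benchmark θ A ε ω) ω - θ (A t ω) ω =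
          searchGain ε fun j => orderedReward θ ξ b ω (t + j)) ∧
      (history θ A t ω ∉ unsatisfactoryHistories ε t → benchmark θ A ε ω = A t ω) := by
  filter_upwards [h.ae_action_eq, h.ae_of_ae_rewardLaw (ae_exists_le h0),
    h.ae_firstSatisfactory_eq h0] with ω hω hex hB
  set x := orderedReward θ ξ b ω with hx
  set σ := hittingTime ε x with hσ
  have hiff : searchHistory θ ξ b t ω ∈ unsatisfactoryHistories ε t ↔ t ≤ σ := by
    rw [le_hittingTime_iff hex]
    exact ⟨fun H k hk => H ⟨k, hk⟩, fun H k => H k k.2⟩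
  have heq : t ≤ σ → history θ A t ω = searchHistory θ ξ b t ω := by
    intro ht
    funext k
    have hk : min (k : ℕ) σ = k := min_eq_left (k.2.le.trans ht)
    have := hω k
    rw [hk] at this
    exact Prod.ext this.1 this.2
  have hiff' : history θ A t ω ∈ unsatisfactoryHistories ε t ↔ t ≤ σ := by
    refine ⟨fun H => not_lt.1 fun hlt => ?_, fun ht => by rw [heq ht]; exact hiff.2 ht⟩
    -- If `σ < t`, the history already contains the satisfactory action played at time `σ`.
    exact absurd hB.1 (not_le.2 (H ⟨σ, hlt⟩))
  refine ⟨hiff'.trans hiff.symm, fun H => ?_, fun H => ?_⟩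
  · have ht := hiff'.1 H
    have hshift := hittingTime_shift hex ht
    have hAt : θ (A t ω) ω = x t := by rw [(hω t).2, min_eq_left ht]
    refine ⟨heq ht, by rw [hB.2.2, hshift], hAt, ?_⟩
    rw [hB.2.2, hAt, searchGain, hshift]
    rfl
  · have ht : σ < t := not_le.1 (mt hiff'.2 H)
    rw [hB.2.2, (hω t).1, min_eq_right ht.le]

/-- The expected shortfall vanishes once a satisfactory action has been found, and is at most `1/2`
before. -/
theorem ae_expectedShortfall (h : IsSequentialSearch μ θ ξ ε A b) (h0 : 0 < ε) (t : ℕ) :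
    ∀ᵐ ω ∂μ, expectedShortfall μ θ A (benchmark θ A ε) t ω =
      (unsatisfactoryHistories ε t).indicator
        (fun _ => ∫ x, searchGain ε x ∂rewardLaw) (history θ A t ω) := by
  have hexp := h.ae_exploration h0 t
  set c := ∫ x, searchGain ε x ∂rewardLaw with hc
  set N := unsatisfactoryHistories ε t
  have hNm : MeasurableSet N := measurableSet_unsatisfactoryHistories ε t
  have hF := h.measurable_history t
  have hF' := h.measurable_searchHistory t
  have hV : Measurable fun ω j => orderedReward θ ξ b ω (t + j) :=
    measurable_pi_iff.2 fun j => (measurable_pi_apply (t + j)).comp h.measurable_orderedReward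
  have hlaw : μ.map (fun ω => (searchHistory θ ξ b t ω, fun j => orderedReward θ ξ b ω (t + j))) =
      (μ.map (searchHistory θ ξ b t)).prod rewardLaw := by
    have := Measure.isProbabilityMeasure_map (μ := μ)
      (hF'.prodMk h.measurable_exogenous).aemeasurable
    exact map_prodMk_comp_left (hF'.prodMk h.measurable_exogenous) hV
      (h.map_searchHistory_shift t) measurable_fst
  -- By independence, the gain may be replaced by its mean when integrated over an event of the
  -- search history.
  have hprod : ∀ S : Set (History t), MeasurableSet S →
      ∫ ω, S.indicator (fun _ => (1 : ℝ)) (searchHistory θ ξ b t ω) *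
        searchGain ε (fun j => orderedReward θ ξ b ω (t + j)) ∂μ =
      ∫ ω, S.indicator (fun _ => (1 : ℝ)) (searchHistory θ ξ b t ω) * c ∂μ := by
    intro S hS
    have hu : Measurable (S.indicator fun _ => (1 : ℝ)) := measurable_const.indicator hS
    have h1 := integral_map (μ := μ) (hF'.prodMk hV).aemeasurable
      (f := fun p => S.indicator (fun _ => (1 : ℝ)) p.1 * searchGain ε p.2)
      ((hu.comp measurable_fst).mul
        ((measurable_searchGain ε).comp measurable_snd)).aestronglyMeasurable
    rw [hlaw, integral_prod_mul, integral_map hF'.aemeasurable hu.aestronglyMeasurable] at h1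
    rw [integral_mul_const, hc, h1]
  have hm : MeasurableSpace.comap (history θ A t) inferInstance ≤ ‹MeasurableSpace Ω› :=
    hF.comap_le
  have hfeq : (fun ω => θ (benchmark θ A ε ω) ω - θ (A t ω) ω) =ᵐ[μ] fun ω =>
      (history θ A t ⁻¹' N).indicator
        (fun ω => searchGain ε fun j => orderedReward θ ξ b ω (t + j)) ω := by
    filter_upwards [hexp] with ω hω
    by_cases hmem : history θ A t ω ∈ N
    · rw [Set.indicator_of_mem (show ω ∈ history θ A t ⁻¹' N from hmem)]
      exact (hω.2.1 hmem).2.2.2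
    · rw [Set.indicator_of_notMem (show ω ∉ history θ A t ⁻¹' N from hmem), hω.2.2 hmem, sub_self]
  have hgain : Integrable (fun ω => searchGain ε fun j => orderedReward θ ξ b ω (t + j)) μ := by
    have hVlaw : μ.map (fun ω j => orderedReward θ ξ b ω (t + j)) = rewardLaw := by
      have := Measure.isProbabilityMeasure_map (μ := μ) hF'.aemeasurable
      rw [← Measure.snd_map_prodMk hF', hlaw, Measure.snd_prod]
    have := integrable_searchGain h0
    rw [← hVlaw] at this
    exact this.comp_measurable hV
  have hfint : Integrable (fun ω => θ (benchmark θ A ε ω) ω - θ (A t ω) ω) μ :=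
    (hgain.indicator (hF hNm)).congr hfeq.symm
  have hgm : Measurable[MeasurableSpace.comap (history θ A t) inferInstance]
      fun ω => N.indicator (fun _ => c) (history θ A t ω) :=
    (measurable_const.indicator hNm).comp (comap_measurable _)
  have hgint : Integrable (fun ω => N.indicator (fun _ => c) (history θ A t ω)) μ :=
    (integrable_const c).indicator (hF hNm)
  refine (ae_eq_condExp_of_forall_setIntegral_eq hm hfint (fun _ _ _ => hgint.integrableOn) ?_
    hgm.stronglyMeasurable.aestronglyMeasurable).symm
  rintro _ ⟨S, hS, rfl⟩ -
  -- The test sets for the conditional expectation are events of the true history. Inside `N` the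
  -- two histories coincide, so these become events of the search history, to which `hprod` applies.
  have hiff : ∀ᵐ ω ∂μ, ω ∈ history θ A t ⁻¹' S ∩ history θ A t ⁻¹' N ↔
      searchHistory θ ξ b t ω ∈ S ∩ N := by
    filter_upwards [hexp] with ω hω
    simp only [Set.mem_inter_iff, Set.mem_preimage]
    by_cases hmem : history θ A t ω ∈ N
    · rw [(hω.2.1 hmem).1]
    · exact iff_of_false (fun H => hmem H.2) fun H => hmem (hω.1.2 H.2)
  have hind : ∀ r : Ω → ℝ, (history θ A t ⁻¹' S).indicator ((history θ A t ⁻¹' N).indicator r) =ᵐ[μ]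
      fun ω => (S ∩ N).indicator (fun _ => (1 : ℝ)) (searchHistory θ ξ b t ω) * r ω := by
    intro r
    filter_upwards [hiff] with ω hω
    rw [Set.indicator_indicator]
    by_cases hmem : ω ∈ history θ A t ⁻¹' S ∩ history θ A t ⁻¹' N
    · rw [Set.indicator_of_mem hmem, Set.indicator_of_mem (hω.1 hmem), one_mul]
    · rw [Set.indicator_of_notMem hmem, Set.indicator_of_notMem (mt hω.2 hmem), zero_mul]
  rw [setIntegral_congr_ae (hF hS) (hfeq.mono fun ω hω _ => hω), ← integral_indicator (hF hS),
    ← integral_indicator (hF hS), integral_congr_ae (hind _), hprod _ (hS.inter hNm),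
    ← integral_congr_ae (hind _)]
  rfl

/-- While nothing satisfactory is known, the posterior law is that of a fresh search: given `ξ = z`,
the benchmark is `b z (t + σ)`, with `σ` the hitting time of a fresh reward sequence, and the
observation is the first term of that sequence. By injectivity of `b z`, the benchmark is `b z t`
exactly when that first reward is satisfactory, so both variables reveal this event of probability
`ε`. -/
theorem ae_le_informationGain [StandardBorelSpace Ξ] [Nonempty Ξ]
    (h : IsSequentialSearch μ θ ξ ε A b) (h0 : 0 < ε) (h1 : ε < 1) (t : ℕ) :
    ∀ᵐ ω ∂μ, history θ A t ω ∈ unsatisfactoryHistories ε t →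
      ENNReal.ofReal (Real.binEntropy ε) ≤
        informationGain μ θ ξ A (benchmark θ A ε) t ω := by
  have hg : Measurable fun p : Ξ × (ℕ → ℝ) => (b p.1 (t + hittingTime ε p.2), p.2 0) :=
    (measurable_index_apply (f := fun p : Ξ × (ℕ → ℝ) => b p.1)
      (fun k => (h.measurable_order k).comp measurable_fst)
      (((measurable_hittingTime ε).comp measurable_snd).const_add t)).prodMk
      ((measurable_pi_apply 0).comp measurable_snd)
  have hK := isMarkovKernel_sectionKernel rewardLaw hg
  have hV : Measurable fun ω j => orderedReward θ ξ b ω (t + j) :=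
    measurable_pi_iff.2 fun j => (measurable_pi_apply (t + j)).comp h.measurable_orderedReward
  have hξ := h.measurable_exogenous
  have hF' := h.measurable_searchHistory t
  have hform := ae_of_ae_map hF'.aemeasurable
    (condDistrib_prodMk_ae_eq hF' hξ hV (h.map_searchHistory_shift t) hg)
  have hexp := h.ae_exploration h0 t
  have hagree := condDistrib_ae_eq_of_agree (h.measurable_history t) hF'
    (hξ.prodMk (h.measurable_benchmark.prodMk (h.measurable_reward_action t)))
    (hξ.prodMk (hg.comp (hξ.prodMk hV))) (measurableSet_unsatisfactoryHistories ε t)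
    (hexp.mono fun ω hω => hω.1)
    (hexp.mono fun ω hω hN => ⟨(hω.2.1 hN).1, by
      obtain ⟨-, e1, e2, -⟩ := hω.2.1 hN
      simp only [Function.comp_apply]
      rw [e1, e2, add_zero]⟩)
  filter_upwards [hexp, hform, hagree] with ω hω hf ha hN
  have hρ := (ha hN).trans ((congrArg _ (hω.2.1 hN).1).trans hf)
  refine le_condMutualInfoOfLaw hρ fun z => ?_
  rw [sectionKernel_apply _ hg]
  refine binEntropy_le_klDiv_of_reveal h0 h1 rewardLaw (f := fun a => decide (a = b z t))
    (g := fun y => decide (1 - ε ≤ y)) ?_ (measurable_pi_apply 0) .of_discrete ?_ ?_ ?_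
  · exact (Measurable.of_discrete (f := b z)).comp ((measurable_hittingTime ε).const_add t)
  · have : (fun y : ℝ => decide (1 - ε ≤ y)) ⁻¹' {true} = Set.Ici (1 - ε) := by ext; simp
    exact measurable_to_bool (this ▸ measurableSet_Ici)
  · filter_upwards [ae_exists_le h0] with x hx
    rw [decide_eq_decide, (h.injective_order z).eq_iff, Nat.add_eq_left, hittingTime_eq_iff hx]
    simp
  · rw [← unitUniform_Ici h1, ← (measurePreserving_eval_rewardLaw 0).measure_preimage
      measurableSet_Ici.nullMeasurableSet]
    congr 1
    ext x
    simp

end IsSequentialSearch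

/-- The reward at time `t` is independent of the first `t` rewards, so the integral is a failure
probability times a mean. -/
lemma integral_indicator_exploration {ε : ℝ} (h0 : 0 < ε) (h1 : ε < 1) (t : ℕ) :
    ∫ x, {x : ℕ → ℝ | ∀ k < t, x k < 1 - ε}.indicator (fun x => 1 - x t) x ∂rewardLaw =
      (1 - ε) ^ t * (1 / 2) := by
  set S : Set (Fin t → ℝ) := Set.univ.pi fun _ => Set.Iio (1 - ε) with hS
  have hSm : MeasurableSet S := MeasurableSet.univ_pi fun _ => measurableSet_Iio
  have hpre : (fun (x : ℕ → ℝ) (k : Fin t) => x k) ⁻¹' S = {x | ∀ k < t, x k < 1 - ε} := by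
    ext x
    simp only [hS, Set.mem_preimage, Set.mem_univ_pi, Set.mem_Iio, Set.mem_ofPred_eq]
    exact ⟨fun H k hk => H ⟨k, hk⟩, fun H k => H k k.2⟩
  have hu : Measurable (S.indicator fun _ => (1 : ℝ)) := measurable_const.indicator hSm
  have hr : Measurable fun (x : ℕ → ℝ) (k : Fin t) => x k := by fun_prop
  have hv : Measurable fun y : ℕ → ℝ => 1 - y 0 := by fun_prop
  have hind := ((indepFun_split_rewardLaw t).comp hu hv).integral_fun_mul_eq_mul_integral
    (hu.comp hr).aestronglyMeasurable
    (hv.comp (by fun_prop : Measurable fun (x : ℕ → ℝ) (j : ℕ) => x (t + j))).aestronglyMeasurable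
  have hone : ∫ x, (S.indicator fun _ => (1 : ℝ)) (fun k : Fin t => x k) ∂rewardLaw =
      (1 - ε) ^ t := by
    change ∫ x, ((fun (x : ℕ → ℝ) (k : Fin t) => x k) ⁻¹' S).indicator
      (fun _ => (1 : ℝ)) x ∂rewardLaw = _
    rw [integral_indicator_const _ (hr hSm), hpre, measureReal_def, rewardLaw_forall_lt h0,
      ENNReal.toReal_pow, ENNReal.toReal_ofReal (by linarith), smul_eq_mul, mul_one]
  have htwo : ∫ x : ℕ → ℝ, (1 - x (t + 0)) ∂rewardLaw = 1 / 2 := by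
    rw [integral_sub (integrable_const _) (integrable_eval_rewardLaw _), integral_eval_rewardLaw]
    norm_num
  rw [← hone, ← htwo]
  refine Eq.trans (integral_congr_ae (Filter.Eventually.of_forall fun x => ?_)) hind
  rw [← hpre]
  simp only [Function.comp_apply, add_zero]
  by_cases hx : (fun k : Fin t => x k) ∈ S
  · rw [Set.indicator_of_mem (show x ∈ _ from hx), Set.indicator_of_mem hx, one_mul]
  · rw [Set.indicator_of_notMem (show x ∉ _ from hx), Set.indicator_of_notMem hx, zero_mul]

namespace IsSequentialSearch

variable {Ω Ξ : Type*} [MeasurableSpace Ω] [MeasurableSpace Ξ] {μ : Measure Ω}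
  [IsProbabilityMeasure μ] {θ : ℕ → Ω → ℝ} {ξ : Ω → Ξ} {A : ℕ → Ω → ℕ} {b : Ξ → ℕ → ℕ}

theorem informationRatio_le [StandardBorelSpace Ξ] [Nonempty Ξ] {ε : unitInterval}
    (h : IsSequentialSearch μ θ ξ ε A b) (hε : (ε : ℝ) ∈ Set.Ioo (0 : ℝ) 1) {α : ℝ}
    (hα : α ∈ Set.Ioo (0 : ℝ) 1) :
    informationRatio μ θ ξ α (benchmark θ A ε) A ≤
      1 / (4 * ENNReal.ofReal ε * entropy μ (firstSatisfactory θ A ε)) := by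
  have hbin := Real.binEntropy_pos hε.1 hε.2
  set C : ℝ≥0∞ := ENNReal.ofReal (1 / 4) / ENNReal.ofReal (Real.binEntropy ε) with hC
  have hterm : ∀ t, ∫⁻ ω, ENNReal.ofReal (expectedShortfall μ θ A (benchmark θ A ε) t ω ^ 2) /
      informationGain μ θ ξ A (benchmark θ A ε) t ω ∂μ ≤ C := by
    intro t
    calc _ ≤ ∫⁻ _, C ∂μ := by
          refine lintegral_mono_ae ?_
          filter_upwards [h.ae_expectedShortfall hε.1 t, h.ae_le_informationGain hε.1 hε.2 t]
            with ω hs hi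
          rw [hs]
          by_cases hmem : history θ A t ω ∈ unsatisfactoryHistories ε t
          · rw [Set.indicator_of_mem hmem]
            obtain ⟨h1, h2⟩ := integral_searchGain_mem hε.1
            -- A shortfall in `[0, 1/2]` has square at most `1/4`.
            exact ENNReal.div_le_div (ENNReal.ofReal_le_ofReal (by nlinarith)) (hi hmem)
          · rw [Set.indicator_of_notMem hmem]
            simp
      _ = C := by simp
  have hα2 : α ^ 2 < 1 := by nlinarith [hα.1, hα.2]
  have hgeom : ENNReal.ofReal (1 - α ^ 2) * ∑' t : ℕ, ENNReal.ofReal (α ^ (2 * t)) = 1 := by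
    simp_rw [pow_mul]
    rw [← ENNReal.ofReal_tsum_of_nonneg (fun t => by positivity)
      (summable_geometric_of_lt_one (by positivity) hα2),
      tsum_geometric_of_lt_one (by positivity) hα2, ← ENNReal.ofReal_mul (by linarith),
      mul_inv_cancel₀ (by linarith), ENNReal.ofReal_one]
  calc informationRatio μ θ ξ α (benchmark θ A ε) A
      ≤ ENNReal.ofReal (1 - α ^ 2) * ∑' t : ℕ, ENNReal.ofReal (α ^ (2 * t)) * C := by
        unfold informationRatio
        gcongr with t
        exact hterm t
    _ = C := by rw [ENNReal.tsum_mul_right, ← mul_assoc, hgeom, one_mul]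
    -- Here `ε H(τ) = h(ε)`, the binary entropy.
    _ = _ := by
        have h4 : (4 : ℝ≥0∞) = ENNReal.ofReal 4 := by norm_num
        rw [h.entropy_firstSatisfactory hε, hC, h4, ← ENNReal.ofReal_mul (by norm_num),
          ← ENNReal.ofReal_mul (by linarith [hε.1]), ← ENNReal.ofReal_one,
          ← ENNReal.ofReal_div_of_pos hbin, ← ENNReal.ofReal_div_of_pos]
        · congr 1
          have := hε.1.ne'
          field_simp
        · have := hε.1
          positivity

/-! ### Discounted regret of the search. -/

variable {ε : ℝ}

lemma ae_regret_mem (h : IsSequentialSearch μ θ ξ ε A b) (h0 : 0 < ε) :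
    ∀ᵐ ω ∂μ, ∀ t, 0 ≤ 1 - θ (A t ω) ω ∧ 1 - θ (A t ω) ω ≤ 1 ∧
      1 - θ (A t ω) ω ≤ ε + {x : ℕ → ℝ | ∀ k < t, x k < 1 - ε}.indicator (fun x => 1 - x t)
        (orderedReward θ ξ b ω) := by
  filter_upwards [h.ae_action_eq, h.ae_of_ae_rewardLaw ae_mem_Icc_rewardLaw,
    h.ae_of_ae_rewardLaw (ae_exists_le h0)] with ω hω hmem hex t
  set x := orderedReward θ ξ b ω
  have hb := hmem (min t (hittingTime ε x))
  rw [(hω t).2]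
  refine ⟨by linarith [hb.2], by linarith [hb.1], ?_⟩
  by_cases ht : t ≤ hittingTime ε x
  · rw [Set.indicator_of_mem (show x ∈ {x : ℕ → ℝ | ∀ k < t, x k < 1 - ε} from
      (le_hittingTime_iff hex t).1 ht), min_eq_left ht]
    linarith
  · rw [Set.indicator_of_notMem (show x ∉ {x : ℕ → ℝ | ∀ k < t, x k < 1 - ε} from
      mt (le_hittingTime_iff hex t).2 ht), min_eq_right (not_le.1 ht).le]
    linarith [le_hittingTime hex]

lemma integrable_regret (h : IsSequentialSearch μ θ ξ ε A b) (h0 : 0 < ε) (t : ℕ) :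
    Integrable (fun ω => 1 - θ (A t ω) ω) μ := by
  refine Integrable.of_bound (C := 1)
    ((h.measurable_reward_action t).const_sub 1).aestronglyMeasurable ?_
  filter_upwards [h.ae_regret_mem h0] with ω hω
  rw [Real.norm_of_nonneg (hω t).1]
  exact (hω t).2.1

lemma integral_regret_le (h : IsSequentialSearch μ θ ξ ε A b) (h0 : 0 < ε) (h1 : ε < 1) (t : ℕ) :
    ∫ ω, (1 - θ (A t ω) ω) ∂μ ≤ ε + (1 - ε) ^ t * (1 / 2) := by
  set f : (ℕ → ℝ) → ℝ := {x : ℕ → ℝ | ∀ k < t, x k < 1 - ε}.indicator (fun x => 1 - x t) with hf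
  have hset : MeasurableSet {x : ℕ → ℝ | ∀ k < t, x k < 1 - ε} := by
    have : {x : ℕ → ℝ | ∀ k < t, x k < 1 - ε} = ⋂ k, ⋂ (_ : k < t), {x | x k < 1 - ε} := by
      ext; simp
    rw [this]
    exact MeasurableSet.iInter fun k => MeasurableSet.iInter fun _ =>
      measurableSet_lt (measurable_pi_apply k) measurable_const
  have hfint : Integrable f (μ.map (orderedReward θ ξ b)) := by
    rw [h.map_orderedReward]
    exact ((integrable_const _).sub (integrable_eval_rewardLaw t)).indicator hset
  have hfX : Integrable (fun ω => f (orderedReward θ ξ b ω)) μ :=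
    hfint.comp_measurable h.measurable_orderedReward
  calc ∫ ω, (1 - θ (A t ω) ω) ∂μ
      ≤ ∫ ω, (ε + f (orderedReward θ ξ b ω)) ∂μ :=
        integral_mono_ae (h.integrable_regret h0 t) ((integrable_const ε).add hfX)
          ((h.ae_regret_mem h0).mono fun ω hω => (hω t).2.2)
    _ = ε + ∫ x, f x ∂rewardLaw := by
        rw [integral_add (integrable_const ε) hfX, ← h.map_orderedReward,
          integral_map h.measurable_orderedReward.aemeasurable hfint.aestronglyMeasurable]
        simp
    _ = _ := by rw [hf, integral_indicator_exploration h0 h1 t]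

lemma ae_summable_regret (h : IsSequentialSearch μ θ ξ ε A b) (h0 : 0 < ε) {α : ℝ}
    (hα : α ∈ Set.Ioo (0 : ℝ) 1) :
    ∀ᵐ ω ∂μ, Summable fun t : ℕ => α ^ t * (1 - θ (A t ω) ω) := by
  filter_upwards [h.ae_regret_mem h0] with ω hω
  refine Summable.of_nonneg_of_le (fun t => mul_nonneg (pow_nonneg hα.1.le t) (hω t).1)
    (fun t => ?_) (summable_geometric_of_lt_one hα.1.le hα.2)
  exact mul_le_of_le_one_right (pow_nonneg hα.1.le t) (hω t).2.1

lemma integrable_tsum_regret (h : IsSequentialSearch μ θ ξ ε A b) (h0 : 0 < ε) {α : ℝ}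
    (hα : α ∈ Set.Ioo (0 : ℝ) 1) :
    Integrable (fun ω => ∑' t : ℕ, α ^ t * (1 - θ (A t ω) ω)) μ := by
  refine Integrable.of_bound (C := (1 - α)⁻¹) ?_ ?_
  · refine aestronglyMeasurable_of_tendsto_ae Filter.atTop
      (f := fun n ω => ∑ t ∈ Finset.range n, α ^ t * (1 - θ (A t ω) ω)) (fun n => ?_) ?_
    · exact (Finset.measurable_fun_sum _ fun t _ =>
        ((h.measurable_reward_action t).const_sub 1).const_mul _).aestronglyMeasurable
    · filter_upwards [h.ae_summable_regret h0 hα] with ω hω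
      exact hω.hasSum.tendsto_sum_nat
  · filter_upwards [h.ae_regret_mem h0, h.ae_summable_regret h0 hα] with ω hω hs
    rw [Real.norm_of_nonneg
      (tsum_nonneg fun t => mul_nonneg (pow_nonneg hα.1.le t) (hω t).1),
      ← tsum_geometric_of_lt_one hα.1.le hα.2]
    exact hs.tsum_le_tsum (fun t => mul_le_of_le_one_right (pow_nonneg hα.1.le t) (hω t).2.1)
      (summable_geometric_of_lt_one hα.1.le hα.2)

theorem integral_tsum_regret_le (h : IsSequentialSearch μ θ ξ ε A b) (h0 : 0 < ε) (h1 : ε < 1)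
    {α : ℝ} (hα : α ∈ Set.Ioo (0 : ℝ) 1) :
    ∫ ω, ∑' t : ℕ, α ^ t * (1 - θ (A t ω) ω) ∂μ ≤ ε / (1 - α) + 1 / (2 * ε) := by
  have hint : ∀ t, Integrable (fun ω => α ^ t * (1 - θ (A t ω) ω)) μ := fun t =>
    (h.integrable_regret h0 t).const_mul _
  have hnorm : ∀ t, ∫ ω, ‖α ^ t * (1 - θ (A t ω) ω)‖ ∂μ = ∫ ω, α ^ t * (1 - θ (A t ω) ω) ∂μ :=
    fun t => integral_congr_ae ((h.ae_regret_mem h0).mono fun ω hω =>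
      Real.norm_of_nonneg (mul_nonneg (pow_nonneg hα.1.le t) (hω t).1))
  have hle : ∀ t, ∫ ω, α ^ t * (1 - θ (A t ω) ω) ∂μ ≤
      ε * α ^ t + 1 / 2 * (1 - ε) ^ t := by
    intro t
    have hp : 0 ≤ (1 - ε) ^ t := pow_nonneg (by linarith) t
    -- The discount is kept on the term `ε` and bounded by `1` on the exploration term, whose sum is
    -- then `1 / (2ε)` whatever `α` is.
    have ha := pow_le_one₀ (n := t) hα.1.le hα.2.le
    have ha' := pow_nonneg hα.1.le t
    rw [integral_const_mul]
    calc α ^ t * ∫ ω, (1 - θ (A t ω) ω) ∂μ ≤ α ^ t * (ε + (1 - ε) ^ t * (1 / 2)) :=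
          mul_le_mul_of_nonneg_left (h.integral_regret_le h0 h1 t) ha'
      _ ≤ _ := by nlinarith
  have hgeom := ((hasSum_geometric_of_lt_one hα.1.le hα.2).mul_left ε).add
    ((hasSum_geometric_of_lt_one (r := 1 - ε) (by linarith) (by linarith)).mul_left (1 / 2))
  have hsum : Summable fun t => ∫ ω, ‖α ^ t * (1 - θ (A t ω) ω)‖ ∂μ := by
    refine Summable.of_nonneg_of_le (fun t => integral_nonneg fun ω => norm_nonneg _)
      (fun t => ?_) hgeom.summable
    rw [hnorm]
    exact hle t
  have hfin := hasSum_integral_of_summable_integral_norm hint hsum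
  refine (hasSum_le hle hfin hgeom).trans (le_of_eq ?_)
  rw [sub_sub_cancel]
  field_simp

end IsSequentialSearch

end SatisficingBandit

end

theorem mainTheorem3 {Ω Ξ : Type*} [MeasurableSpace Ω] [MeasurableSpace Ξ]
    [StandardBorelSpace Ξ] [Nonempty Ξ]
    (μ : Measure Ω) [IsProbabilityMeasure μ]
    (θ : ℕ → Ω → ℝ) (ξ : Ω → Ξ) (hB : SatisficingBandit.IsDeterministicBandit μ θ ξ)
    (α : ℝ) (hα : α ∈ Set.Ioo (0 : ℝ) 1)
    (ε : unitInterval) (hε : (ε : ℝ) ∈ Set.Ioo (0 : ℝ) 1)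
    (A : ℕ → Ω → ℕ) (hA : SatisficingBandit.IsSTS μ θ ξ ε A) :
    -- `τ` is almost surely finite and geometric on `{0, 1, 2, …}`, with positive finite entropy
    (∀ᵐ ω ∂μ, ∃ t, 1 - (ε : ℝ) ≤ θ (A t ω) ω) ∧
    μ.map (SatisficingBandit.firstSatisfactory θ A ε) = geometricMeasure ε ∧
    0 < SatisficingBandit.entropy μ (SatisficingBandit.firstSatisfactory θ A ε) ∧
    SatisficingBandit.entropy μ (SatisficingBandit.firstSatisfactory θ A ε) < ∞ ∧
    -- `H(Ã | ξ) = H(τ)`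
    SatisficingBandit.condEntropy μ (SatisficingBandit.benchmark θ A ε) ξ =
      SatisficingBandit.entropy μ (SatisficingBandit.firstSatisfactory θ A ε) ∧
    -- `Γ(Ã, {A_t}) ≤ 1 / (4 ε H(τ))`
    SatisficingBandit.informationRatio μ θ ξ α (SatisficingBandit.benchmark θ A ε) A ≤
      1 / (4 * ENNReal.ofReal ε *
        SatisficingBandit.entropy μ (SatisficingBandit.firstSatisfactory θ A ε)) ∧
    -- the bound on expected discounted regret
    ((ε : ℝ) = Real.sqrt ((1 - α) / 2) →
      (∀ᵐ ω ∂μ, Summable fun t : ℕ =>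
        α ^ t * (SatisficingBandit.optReward θ ω - θ (A t ω) ω)) ∧
      Integrable (fun ω => ∑' t : ℕ,
        α ^ t * (SatisficingBandit.optReward θ ω - θ (A t ω) ω)) μ ∧
      ∫ ω, ∑' t : ℕ, α ^ t * (SatisficingBandit.optReward θ ω - θ (A t ω) ω) ∂μ
        ≤ Real.sqrt (2 / (1 - α))) := by
  obtain ⟨b, h⟩ := hA.exists_isSequentialSearch hB hε.1
  have hent := h.entropy_firstSatisfactory hε
  have hpos : 0 < Real.binEntropy (ε : ℝ) / (ε : ℝ) :=
    div_pos (Real.binEntropy_pos hε.1 hε.2) hε.1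
  refine ⟨(h.ae_firstSatisfactory_eq hε.1).mono fun ω hω => ⟨_, hω.1⟩, h.map_firstSatisfactory hε,
    ?_, ?_, h.condEntropy_benchmark hε, h.informationRatio_le hε hα, fun hεα => ?_⟩
  · rw [hent]
    exact ENNReal.ofReal_pos.2 hpos
  · rw [hent]
    exact ENNReal.ofReal_lt_top
  · have hopt : ∀ᵐ ω ∂μ, ∀ t : ℕ, α ^ t * (SatisficingBandit.optReward θ ω - θ (A t ω) ω) =
        α ^ t * (1 - θ (A t ω) ω) :=
      hB.ae_optReward.mono fun ω hω t => by rw [hω]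
    have htsum : (fun ω => ∑' t : ℕ, α ^ t * (SatisficingBandit.optReward θ ω - θ (A t ω) ω)) =ᵐ[μ]
        fun ω => ∑' t : ℕ, α ^ t * (1 - θ (A t ω) ω) :=
      hopt.mono fun ω hω => tsum_congr hω
    refine ⟨?_, (h.integrable_tsum_regret hε.1 hα).congr htsum.symm, ?_⟩
    · filter_upwards [hopt, h.ae_summable_regret hε.1 hα] with ω hω hs
      exact hs.congr fun t => (hω t).symm
    · rw [integral_congr_ae htsum]
      refine (h.integral_tsum_regret_le hε.1 hε.2 hα).trans (le_of_eq ?_)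
      -- With `1 - α = 2 ε²`, both terms of the bound equal `1 / (2ε)`, and their sum `1 / ε` is the
      -- required square root.
      have hsq : (ε : ℝ) ^ 2 = (1 - α) / 2 := by
        rw [hεα, Real.sq_sqrt (by linarith [hα.2])]
      have hone : 1 - α = 2 * (ε : ℝ) ^ 2 := by linarith
      have hinv : Real.sqrt (2 / (1 - α)) = (ε : ℝ)⁻¹ := by
        rw [← inv_div, Real.sqrt_inv, ← hεα]
      have := hε.1.ne'
      rw [hinv, hone]
      field_simp
      norm_num
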